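/- Let $A\in\mathbb{R}^{n\times n}$, $B\in\mathbb{R}^{n\times m}$, $C\in\mathbb{R}^{q\times n}$, with $(A,B)$ controllable, $(A,C)$ observable, and $A$ neutrally stable: all eigenvalues of $A$ lie in the closed left half plane and those on the imaginary axis are semi-simple. Let $\sigma(v)=(\operatorname{sat}(v_1),\dots,\operatorname{sat}(v_m))^T$ with $\operatorname{sat}(w)=\operatorname{sgn}(w)\min(1,|w|)$. Consider $N$ agents and an exosystem $$\dot x_i=Ax_i+B\sigma(u_i),\quad y_i=Cx_i\quad(i=1,\dots,N),\qquad \dot x_r=Ax_r,\quad y_r=Cx_r .$$ The network is a weighted directed graph with adjacency matrix $[a_{ij}]$, $a_{ij}\ge 0$, $a_{ii}=0$, where $a_{ij}>0$ means that there is an edge from $j$ to $i$. A nonempty set $\mathscr{C}\subseteq\{1,\dots,N\}$ of agents has access to the exosystem; $\iota_i=1$ if $i\in\mathscr{C}$ and $\iota_i=0$ otherwise. Let $\mathbb{G}^N_{\mathscr{C}}$ be the set of such graphs on $N$ nodes in which every node belongs to a directed tree (a subgraph) whose root lies in $\mathscr{C}$. Agent $i$ receives $$\bar\zeta_i=\sum_{j=1}^N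 a_{ij}(y_i-y_j)+\iota_i(y_i-y_r),\qquad \hat\zeta_i=\sum_{j=1}^N a_{ij}(\xi_i-\xi_j),$$ where $\xi_i$ is a variable produced by the protocol of agent $i$. Regulated state synchronization means $x_i(t)-x_r(t)\to0$, and hence $x_i(t)-x_j(t)\to 0$, as $t\to\infty$, for all $i,j$. Then: 1. The scalable global regulated state synchronization problem is solvable: there is a linear dynamic protocol of the form $$\dot x_{c,i}=A_cx_{c,i}+B_c\sigma(u_i)+C_c\bar\zeta_i+D_c\hat\zeta_i+\iota_i\bigl(A_\iota x_{c,i}+B_\iota\sigma(u_i)\bigr),\quad u_i=F_cx_{c,i},\quad \xi_i=H_cx_{c,i}+G_c\sigma(u_i),$$ whose coefficient matrices depend only on $(A,B,C)$, such that for every $N$, every nonempty $\mathscr{C}$ and every graph in $\mathbb{G}^N_{\mathscr{C}}$ the closed-loop system has a solution on $[0,\infty)$ for all initial conditions of agents, exosystem and protocols, and every solution achieves regulated state synchronization. 2. There exist a symmetric matrix $P>0$ with $PA+A^TP\le 0$ and a matrix $F$ such that $A-FC$ is Hurwitz stable. 3. For every $\rho>0$, every such $P$ and every such $F$, every $N$,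 every nonempty $\mathscr{C}\subseteq\{1,\dots,N\}$ and every graph in $\mathbb{G}^N_{\mathscr{C}}$, the protocol $$\begin{aligned}\dot{\hat x}_i&=A\hat x_i+B\hat\zeta_{i2}+F(\bar\zeta_i-C\hat x_i)+\iota_iB\sigma(u_i),\\ \dot\chi_i&=A\chi_i+B\sigma(u_i)+\hat x_i-\hat\zeta_{i1}-\iota_i\chi_i,\\ u_i&=-\rho B^TP\chi_i,\end{aligned}$$ with $\hat\zeta_{i1}=\sum_j a_{ij}(\chi_i-\chi_j)$ and $\hat\zeta_{i2}=\sum_j a_{ij}(\sigma(u_i)-\sigma(u_j))$, achieves regulated state synchronization: for all initial conditions of $x_i,x_r,\hat x_i,\chi_i$ the closed-loop system has a solution on $[0,\infty)$, and for every solution $x_i(t)-x_r(t)\to0$ and $x_i(t)-x_j(t)\to0$ for all $i,j$. -/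

import Mathlib

open scoped Matrix
open Filter Topology

namespace SatMAS

/-! ### Matrices and linear systems -/

/-- The real matrix `A`, acting on complex vectors. -/
noncomputable def complexify {n : ℕ} (A : Matrix (Fin n) (Fin n) ℝ) :
    Module.End ℂ (Fin n → ℂ) :=
  Matrix.toLin' (A.map (algebraMap ℝ ℂ))

/-- All (complex) eigenvalues lie in the open left half plane. -/
def IsHurwitz {n : ℕ} (A : Matrix (Fin n) (Fin n) ℝ) : Prop :=
  ∀ μ : ℂ, (complexify A).HasEigenvalue μ → μ.re < 0

/-- All (complex) eigenvalues lie in the closed left half plane, and those on the imaginary axis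
are semi-simple: the generalized eigenspace is the eigenspace, i.e. the algebraic and geometric
multiplicities agree. -/
def IsNeutrallyStable {n : ℕ} (A : Matrix (Fin n) (Fin n) ℝ) : Prop :=
  ∀ μ : ℂ, (complexify A).HasEigenvalue μ →
    μ.re ≤ 0 ∧
      (μ.re = 0 → (complexify A).maxGenEigenspace μ = (complexify A).eigenspace μ)

/-- The controllability matrix `[B, AB, …, A^(n-1) B]`. -/
def controllabilityMatrix {n m : ℕ} (A : Matrix (Fin n) (Fin n) ℝ)
    (B : Matrix (Fin n) (Fin m) ℝ) : Matrix (Fin n) (Fin n × Fin m) ℝ :=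
  Matrix.of fun i p => (A ^ (p.1 : ℕ) * B) i p.2

/-- The observability matrix, with the blocks `C, CA, …, C A^(n-1)` on top of each other. -/
def observabilityMatrix {n q : ℕ} (A : Matrix (Fin n) (Fin n) ℝ)
    (C : Matrix (Fin q) (Fin n) ℝ) : Matrix (Fin n × Fin q) (Fin n) ℝ :=
  Matrix.of fun p j => (C * A ^ (p.1 : ℕ)) p.2 j

/-- Controllability of the pair `(A, B)`. -/
def IsControllable {n m : ℕ} (A : Matrix (Fin n) (Fin n) ℝ)
    (B : Matrix (Fin n) (Fin m) ℝ) : Prop :=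
  (controllabilityMatrix A B).rank = n

/-- Observability of the pair `(A, C)`. -/
def IsObservable {n q : ℕ} (A : Matrix (Fin n) (Fin n) ℝ)
    (C : Matrix (Fin q) (Fin n) ℝ) : Prop :=
  (observabilityMatrix A C).rank = n

/-- `P > 0` (symmetric positive definite) and `P A + Aᵀ P ≤ 0`. -/
def IsLyapunovMatrix {n : ℕ} (A P : Matrix (Fin n) (Fin n) ℝ) : Prop :=
  P.PosDef ∧ (-(P * A + Aᵀ * P)).PosSemidef

/-- The standard saturation function `sgn(w) min(1, |w|)`. -/
noncomputable def sat (w : ℝ) : ℝ := Real.sign w * min 1 |w|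

/-- Componentwise saturation of a vector. -/
noncomputable def satVec {m : ℕ} (v : Fin m → ℝ) : Fin m → ℝ := fun k => sat (v k)

/-! ### Communication graphs -/

/-- A weighted directed graph on `N` nodes: `weight i j` is the entry `a_ij` of the weighted
adjacency matrix. -/
structure WeightedGraph (N : ℕ) where
  weight : Matrix (Fin N) (Fin N) ℝ
  weight_nonneg : ∀ i j, 0 ≤ weight i j
  weight_self : ∀ i, weight i i = 0

/-- There is an edge from `j` to `i` when `a_ij > 0`. -/
def WeightedGraph.Edge {N : ℕ} (G : WeightedGraph N) (j i : Fin N) : Prop := 0 < G.weight i j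

/-- The subgraph of `G` with node set `V` and edge relation `E` (`E j i`: an edge from `j` to `i`)
is a directed tree with root `r`. -/
structure WeightedGraph.IsDirectedTree {N : ℕ} (G : WeightedGraph N) (V : Set (Fin N))
    (E : Fin N → Fin N → Prop) (r : Fin N) : Prop where
  root_mem : r ∈ V
  edge_sub : ∀ j i, E j i → j ∈ V ∧ i ∈ V ∧ G.Edge j i
  root_no_parent : ∀ j, ¬ E j r
  unique_parent : ∀ i ∈ V, i ≠ r → ∃! j, E j i
  reachable : ∀ i ∈ V, Relation.ReflTransGen E r i

/-- The set of graphs on `N` nodes in which every node is a member of a directed tree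
whose root lies in `𝒞`. -/
def rootedGraphs (N : ℕ) (𝒞 : Finset (Fin N)) : Set (WeightedGraph N) :=
  {G | ∀ i, ∃ (V : Set (Fin N)) (E : Fin N → Fin N → Prop) (r : Fin N),
    r ∈ 𝒞 ∧ i ∈ V ∧ G.IsDirectedTree V E r}

/-- `ι_i = 1` if `i ∈ 𝒞` and `0` otherwise. -/
def leaderIndicator {N : ℕ} (𝒞 : Finset (Fin N)) (i : Fin N) : ℝ := if i ∈ 𝒞 then 1 else 0

/-- The localized exchange `∑_j a_ij (ξ_i - ξ_j)`. -/
def exchange {N : ℕ} {κ : Type} (G : WeightedGraph N) (ξ : Fin N → κ → ℝ) (i : Fin N) : κ → ℝ :=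
  ∑ j, G.weight i j • (ξ i - ξ j)

/-- The measurement `∑_j a_ij (y_i - y_j) + ι_i (y_i - y_r)`. -/
def measurement {N q : ℕ} (G : WeightedGraph N) (𝒞 : Finset (Fin N))
    (y : Fin N → Fin q → ℝ) (yr : Fin q → ℝ) (i : Fin N) : Fin q → ℝ :=
  exchange G y i + leaderIndicator 𝒞 i • (y i - yr)

/-! ### Trajectories -/

/-- `z` is differentiable on `[0, ∞)` with derivative `f` there. -/
def HasDynamics {κ : Type} [Fintype κ] (z f : ℝ → κ → ℝ) : Prop :=
  ∀ t, 0 ≤ t → HasDerivWithinAt z (f t) (Set.Ici 0) t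

/-- All agents converge to the exosystem trajectory, and hence to each other. -/
def RegulatedSync {N n : ℕ} (x : Fin N → ℝ → Fin n → ℝ) (xr : ℝ → Fin n → ℝ) : Prop :=
  (∀ i, Tendsto (fun t => x i t - xr t) atTop (𝓝 0)) ∧
    ∀ i j, Tendsto (fun t => x i t - x j t) atTop (𝓝 0)

/-! ### The synchronization problem for general linear protocols -/

/-- A linear dynamic protocol with state space `ℝ^κ` and exchanged variable in `ℝ^ν`,
for agents with `m` inputs and `q` outputs:
`ẋ_c = A_c x_c + B_c σ(u) + C_c ζbar + D_c ζhat + ι (A_ι x_c + B_ι σ(u))`, `u = F_c x_c`,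
`ξ = H_c x_c + G_c σ(u)`, where `ι` tells the agent whether it has access to the exosystem. -/
structure LinearProtocol (m q : ℕ) (κ ν : Type) where
  Ac : Matrix κ κ ℝ
  Bc : Matrix κ (Fin m) ℝ
  Cc : Matrix κ (Fin q) ℝ
  Dc : Matrix κ ν ℝ
  Aι : Matrix κ κ ℝ
  Bι : Matrix κ (Fin m) ℝ
  Fc : Matrix (Fin m) κ ℝ
  Hc : Matrix ν κ ℝ
  Gc : Matrix ν (Fin m) ℝ

section

variable {m q : ℕ} {κ ν : Type} [Fintype κ] [Fintype ν]

/-- The input `u = F_c x_c`. -/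
def LinearProtocol.input (K : LinearProtocol m q κ ν) (xc : κ → ℝ) : Fin m → ℝ := K.Fc *ᵥ xc

/-- The exchanged variable `ξ = H_c x_c + G_c σ(u)`. -/
noncomputable def LinearProtocol.exchanged (K : LinearProtocol m q κ ν) (xc : κ → ℝ) : ν → ℝ :=
  K.Hc *ᵥ xc + K.Gc *ᵥ satVec (K.input xc)

/-- `(x, xr, xc)` is a trajectory on `[0, ∞)` of the agents, the exosystem and the protocols. -/
structure LinearProtocol.IsSolution {n N : ℕ} (K : LinearProtocol m q κ ν)
    (A : Matrix (Fin n) (Fin n) ℝ) (B : Matrix (Fin n) (Fin m) ℝ) (C : Matrix (Fin q) (Fin n) ℝ)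
    (G : WeightedGraph N) (𝒞 : Finset (Fin N))
    (x : Fin N → ℝ → Fin n → ℝ) (xr : ℝ → Fin n → ℝ) (xc : Fin N → ℝ → κ → ℝ) : Prop where
  agents : ∀ i, HasDynamics (x i) fun t => A *ᵥ x i t + B *ᵥ satVec (K.input (xc i t))
  exosystem : HasDynamics xr fun t => A *ᵥ xr t
  protocol : ∀ i, HasDynamics (xc i) fun t =>
    K.Ac *ᵥ xc i t + K.Bc *ᵥ satVec (K.input (xc i t))
      + K.Cc *ᵥ measurement G 𝒞 (fun j => C *ᵥ x j t) (C *ᵥ xr t) i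
      + K.Dc *ᵥ exchange G (fun j => K.exchanged (xc j t)) i
      + leaderIndicator 𝒞 i • (K.Aι *ᵥ xc i t + K.Bι *ᵥ satVec (K.input (xc i t)))

/-- The protocol achieves regulated state synchronization for every number of agents, every
nonempty root set, every graph in the corresponding set, and all initial conditions. -/
def LinearProtocol.AchievesScalableSync {n : ℕ} (K : LinearProtocol m q κ ν)
    (A : Matrix (Fin n) (Fin n) ℝ) (B : Matrix (Fin n) (Fin m) ℝ)
    (C : Matrix (Fin q) (Fin n) ℝ) : Prop :=
  ∀ (N : ℕ) (𝒞 : Finset (Fin N)), 𝒞.Nonempty → ∀ G ∈ rootedGraphs N 𝒞,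
    (∀ (x₀ : Fin N → Fin n → ℝ) (xr₀ : Fin n → ℝ) (xc₀ : Fin N → κ → ℝ),
      ∃ x xr xc, K.IsSolution A B C G 𝒞 x xr xc ∧
        (∀ i, x i 0 = x₀ i) ∧ xr 0 = xr₀ ∧ ∀ i, xc i 0 = xc₀ i) ∧
    ∀ x xr xc, K.IsSolution A B C G 𝒞 x xr xc → RegulatedSync x xr

end

/-- The scalable global regulated state synchronization problem is solvable for the agent model
`(A, B, C)`: one finite-dimensional linear protocol works for all networks. -/
def ScalableSyncSolvable {n m q : ℕ} (A : Matrix (Fin n) (Fin n) ℝ)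
    (B : Matrix (Fin n) (Fin m) ℝ) (C : Matrix (Fin q) (Fin n) ℝ) : Prop :=
  ∃ (κ ν : Type) (_ : Fintype κ) (_ : Fintype ν) (K : LinearProtocol m q κ ν),
    K.AchievesScalableSync A B C

/-! ### The observer-based protocol -/

/-- The input `u = -ρ Bᵀ P χ`. -/
def feedback {n m : ℕ} (B : Matrix (Fin n) (Fin m) ℝ) (P : Matrix (Fin n) (Fin n) ℝ) (ρ : ℝ)
    (χ : Fin n → ℝ) : Fin m → ℝ :=
  -(ρ • ((Bᵀ * P) *ᵥ χ))

/-- `(x, xr, xh, χ)` is a trajectory on `[0, ∞)` of the agents, the exosystem and the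
observer-based protocols. -/
structure IsObserverSolution {n m q N : ℕ}
    (A : Matrix (Fin n) (Fin n) ℝ) (B : Matrix (Fin n) (Fin m) ℝ) (C : Matrix (Fin q) (Fin n) ℝ)
    (P : Matrix (Fin n) (Fin n) ℝ) (F : Matrix (Fin n) (Fin q) ℝ) (ρ : ℝ)
    (G : WeightedGraph N) (𝒞 : Finset (Fin N))
    (x : Fin N → ℝ → Fin n → ℝ) (xr : ℝ → Fin n → ℝ)
    (xh χ : Fin N → ℝ → Fin n → ℝ) : Prop where
  agents : ∀ i, HasDynamics (x i) fun t =>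
    A *ᵥ x i t + B *ᵥ satVec (feedback B P ρ (χ i t))
  exosystem : HasDynamics xr fun t => A *ᵥ xr t
  observer : ∀ i, HasDynamics (xh i) fun t =>
    A *ᵥ xh i t
      + B *ᵥ exchange G (fun j => satVec (feedback B P ρ (χ j t))) i
      + F *ᵥ (measurement G 𝒞 (fun j => C *ᵥ x j t) (C *ᵥ xr t) i - C *ᵥ xh i t)
      + leaderIndicator 𝒞 i • (B *ᵥ satVec (feedback B P ρ (χ i t)))
  controller : ∀ i, HasDynamics (χ i) fun t =>
    A *ᵥ χ i t + B *ᵥ satVec (feedback B P ρ (χ i t)) + xh i t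
      - exchange G (fun j => χ j t) i - leaderIndicator 𝒞 i • χ i t

/-- The observer-based protocol achieves regulated state synchronization on the network `G` with
root set `𝒞`: solutions exist for all initial conditions, and all of them synchronize. -/
def ObserverProtocolAchievesSync {n m q N : ℕ}
    (A : Matrix (Fin n) (Fin n) ℝ) (B : Matrix (Fin n) (Fin m) ℝ) (C : Matrix (Fin q) (Fin n) ℝ)
    (P : Matrix (Fin n) (Fin n) ℝ) (F : Matrix (Fin n) (Fin q) ℝ) (ρ : ℝ)
    (G : WeightedGraph N) (𝒞 : Finset (Fin N)) : Prop :=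
  (∀ (x₀ : Fin N → Fin n → ℝ) (xr₀ : Fin n → ℝ) (xh₀ χ₀ : Fin N → Fin n → ℝ),
    ∃ x xr xh χ, IsObserverSolution A B C P F ρ G 𝒞 x xr xh χ ∧
      (∀ i, x i 0 = x₀ i) ∧ xr 0 = xr₀ ∧ (∀ i, xh i 0 = xh₀ i) ∧ ∀ i, χ i 0 = χ₀ i) ∧
  ∀ x xr xh χ, IsObserverSolution A B C P F ρ G 𝒞 x xr xh χ → RegulatedSync x xr

end SatMAS

/-! Write `e_i = x_i - x_r`, so `e_i' = A e_i + B σ(u_i)`, and let `L` be the Laplacian with the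
links to the exosystem added on its diagonal. The measurement of agent `i` is then `C ∑_j L_ij e_j`,
and the closed loop is a cascade.

The signal `∑_j L_ij e_j - x̂_i` obeys the autonomous linear system with matrix `A - F C`: the
exchanged saturated inputs cancel exactly, so saturation does not enter
(`IsObserverSolution.expDecay_observer_error`). The stacked differences `e_i - χ_i` obey a linear
system with matrix `I ⊗ A - L ⊗ I`, forced by the previous signal. Every eigenvalue of that matrix
is an eigenvalue of `A` minus an eigenvalue of `L`, and the rooted trees force the latter into the
open right half plane, so these differences decay exponentially too
(`re_eigenvalue_groundedLaplacian_pos`, `re_eigenvalue_networkMatrix_neg`). What remains is, for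
each agent separately, `χ' = A χ + B σ(-ρ Bᵀ P χ) + f` with `f` exponentially small.

For this last system (`ExpDecay.of_saturated`) the form of `P` first shows that `χ` is bounded. Then
a multiple of that form is added to a strict Lyapunov form of the Hurwitz matrix `A - ρ B Bᵀ P`. The
gap between `s` and `σ(s)` is at most the dissipation `∑ s_k sat(s_k)`, so on a bounded set the
decrease of the `P`-form pays for the saturation. Hence `χ_i`, and with it `e_i`, tends to zero.

The quadratic Lyapunov functions come from induction on dimension over `ℂ`
(`exists_strict_lyapunov`, `exists_lyapunov`). Solutions exist globally because the closed-loop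
vector field is globally Lipschitz. -/

namespace SatMAS

/-! ### Global solutions of globally Lipschitz differential equations -/

/-- Clamping all coordinates to `[-R, R]`. -/
noncomputable def clamp {κ : Type*} (R : ℝ) (z : κ → ℝ) : κ → ℝ := fun k => max (-R) (min R (z k))

theorem lipschitzWith_clamp {κ : Type*} [Fintype κ] (R : ℝ) :
    LipschitzWith 1 (clamp R : (κ → ℝ) → κ → ℝ) := by
  refine LipschitzWith.of_dist_le_mul fun x y => ?_
  rw [NNReal.coe_one, one_mul, dist_pi_le_iff dist_nonneg]
  intro k
  refine le_trans ?_ (dist_le_pi_dist x y k)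
  have := ((LipschitzWith.id (α := ℝ)).const_min R).const_max (-R) |>.dist_le_mul (x k) (y k)
  simpa [clamp] using this

theorem norm_clamp_le {κ : Type*} [Fintype κ] {R : ℝ} (hR : 0 ≤ R) (z : κ → ℝ) :
    ‖clamp R z‖ ≤ R := by
  rw [pi_norm_le_iff_of_nonneg hR]
  intro k
  rw [Real.norm_eq_abs, abs_le]
  exact ⟨le_max_left _ _, max_le (by linarith) (min_le_left _ _)⟩

theorem clamp_of_norm_le {κ : Type*} [Fintype κ] {R : ℝ} {z : κ → ℝ} (hz : ‖z‖ ≤ R) :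
    clamp R z = z := by
  funext k
  have := abs_le.1 ((norm_le_pi_norm z k).trans hz)
  simp [clamp, this.1, this.2]

theorem norm_clamp_le_norm {κ : Type*} [Fintype κ] {R : ℝ} (hR : 0 ≤ R) (z : κ → ℝ) :
    ‖clamp R z‖ ≤ ‖z‖ := by
  rcases le_total ‖z‖ R with h | h
  · rw [clamp_of_norm_le h]
  · exact (norm_clamp_le hR z).trans h

/-- Picard–Lindelöf on an interval of prescribed length needs a bounded field, so `v` is first
composed with a clamp. The Grönwall bound holds for the clamped equation as well, because clamping
does not increase norms; with the clamp level equal to that bound, the clamp never acts on the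
solution. -/
theorem exists_hasDerivWithinAt_Icc {κ : Type*} [Fintype κ] {K : NNReal}
    {v : (κ → ℝ) → κ → ℝ} (hv : LipschitzWith K v) (z₀ : κ → ℝ) {S : ℝ} (hS : 0 ≤ S) :
    ∃ z : ℝ → κ → ℝ, z 0 = z₀ ∧
      ∀ t ∈ Set.Icc 0 S, HasDerivWithinAt z (v (z t)) (Set.Icc 0 S) t := by
  set R : ℝ := gronwallBound ‖z₀‖ K ‖v 0‖ S with hRdef
  have hmono : Monotone (gronwallBound ‖z₀‖ K ‖v 0‖) :=
    gronwallBound_mono (norm_nonneg _) (norm_nonneg _) K.2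
  have hR : 0 ≤ R := by
    have := hmono hS
    rw [gronwallBound_x0] at this
    exact (norm_nonneg _).trans this
  have hgrow : ∀ z, ‖v (clamp R z)‖ ≤ K * ‖clamp R z‖ + ‖v 0‖ := fun z => by
    have h1 := hv.dist_le_mul (clamp R z) 0
    rw [dist_eq_norm, dist_zero_right] at h1
    have h2 := norm_sub_norm_le (v (clamp R z)) (v 0)
    linarith
  -- The ball has radius (speed bound) times `S`, so the solution cannot leave it before time `S`.
  have hpl : IsPicardLindelof (fun _ z => v (clamp R z)) (⟨0, le_refl _, hS⟩ : Set.Icc (0 : ℝ) S) z₀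
      ((K * R.toNNReal + ‖v 0‖₊) * S.toNNReal) 0 (K * R.toNNReal + ‖v 0‖₊) K := by
    refine ⟨fun t _ => ?_, fun z _ => continuousOn_const, fun t _ z _ => ?_, ?_⟩
    · have := (hv.comp (lipschitzWith_clamp R)).lipschitzOnWith
        (s := Metric.closedBall z₀ ((K * R.toNNReal + ‖v 0‖₊) * S.toNNReal : NNReal))
      rwa [mul_one] at this
    · refine (hgrow z).trans ?_
      simp only [NNReal.coe_add, NNReal.coe_mul, Real.coe_toNNReal _ hR, coe_nnnorm]
      gcongr
      exact norm_clamp_le hR z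
    · simp [hS, Real.coe_toNNReal _ hS]
  obtain ⟨α, h0, hα⟩ := hpl.exists_eq_forall_mem_Icc_hasDerivWithinAt₀
  refine ⟨α, h0, fun t ht => ?_⟩
  have hb : ‖α t‖ ≤ R := by
    refine (norm_le_gronwallBound_of_norm_deriv_right_le (f := α)
      (f' := fun t => v (clamp R (α t))) (δ := ‖z₀‖) (K := K) (ε := ‖v 0‖)
      (fun s hs => (hα s hs).continuousWithinAt) (fun s hs => ?_) (by simp [h0])
      (fun s hs => ?_) t ht).trans ?_
    · exact (hα s ⟨hs.1, hs.2.le⟩).mono_of_mem_nhdsWithin (Icc_mem_nhdsGE_of_mem hs)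
    · refine (hgrow _).trans ?_
      gcongr
      exact norm_clamp_le_norm hR _
    · exact hmono (by linarith [ht.2])
  have := hα t ht
  rwa [clamp_of_norm_le hb] at this

theorem exists_hasDerivWithinAt_Ici_pi {κ : Type*} [Fintype κ] {K : NNReal}
    {v : (κ → ℝ) → κ → ℝ} (hv : LipschitzWith K v) (z₀ : κ → ℝ) :
    ∃ z : ℝ → κ → ℝ, z 0 = z₀ ∧ ∀ t, 0 ≤ t → HasDerivWithinAt z (v (z t)) (Set.Ici 0) t := by
  have hex : ∀ n : ℕ, ∃ z : ℝ → κ → ℝ, z 0 = z₀ ∧ ∀ t ∈ Set.Icc (0 : ℝ) (n + 1),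
      HasDerivWithinAt z (v (z t)) (Set.Icc 0 (n + 1)) t :=
    fun n => exists_hasDerivWithinAt_Icc hv z₀ (by positivity)
  choose zs h0 hd using hex
  have huniq : ∀ m n : ℕ, m ≤ n → ∀ t ∈ Set.Icc (0 : ℝ) (m + 1), zs m t = zs n t := by
    intro m n hmn
    have hsub : Set.Icc (0 : ℝ) (m + 1) ⊆ Set.Icc 0 (n + 1) :=
      Set.Icc_subset_Icc_right (by gcongr)
    refine ODE_solution_unique (v := fun _ => v) (K := K) (fun _ => hv)
      (fun t ht => (hd m t ht).continuousWithinAt) (fun t ht => ?_)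
      (fun t ht => ((hd n t (hsub ht)).mono hsub).continuousWithinAt) (fun t ht => ?_)
      ((h0 m).trans (h0 n).symm)
    · exact (hd m t ⟨ht.1, ht.2.le⟩).mono_of_mem_nhdsWithin (Icc_mem_nhdsGE_of_mem ht)
    · exact ((hd n t (hsub ⟨ht.1, ht.2.le⟩)).mono hsub).mono_of_mem_nhdsWithin
        (Icc_mem_nhdsGE_of_mem ht)
  -- The `n`-th solution lives on `[0, n + 1]`, which reaches strictly beyond every `t` with `⌊t⌋₊ =
  -- n`; near such a `t` the glued function is therefore one fixed solution.
  refine ⟨fun t => zs ⌊t⌋₊ t, by simp [h0], fun t ht => ?_⟩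
  set n := ⌊t⌋₊
  have htn : t < n + 1 := Nat.lt_floor_add_one t
  have hloc : ∀ s ∈ Set.Ico (0 : ℝ) (n + 1), zs ⌊s⌋₊ s = zs n s := fun s hs =>
    huniq _ _ (Nat.lt_succ_iff.1 ((Nat.floor_lt hs.1).2 (by exact_mod_cast hs.2))) s
      ⟨hs.1, (Nat.lt_floor_add_one s).le⟩
  have hmem : Set.Ico (0 : ℝ) (n + 1) ∈ 𝓝[Set.Ici 0] t := by
    rw [← Set.Ici_inter_Iio]
    exact inter_mem_nhdsWithin _ (Iio_mem_nhds htn)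
  have h1 : HasDerivWithinAt (zs n) (v (zs n t)) (Set.Ici 0) t :=
    (hd n t ⟨ht, htn.le⟩).mono_of_mem_nhdsWithin (mem_of_superset hmem Set.Ico_subset_Icc_self)
  exact h1.congr_of_eventuallyEq (mem_of_superset hmem hloc) rfl

theorem exists_hasDerivWithinAt_Ici {E : Type*} [NormedAddCommGroup E] [NormedSpace ℝ E]
    [FiniteDimensional ℝ E] {K : NNReal} {v : E → E} (hv : LipschitzWith K v) (z₀ : E) :
    ∃ z : ℝ → E, z 0 = z₀ ∧ ∀ t, 0 ≤ t → HasDerivWithinAt z (v (z t)) (Set.Ici 0) t := by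
  let Φ : E ≃L[ℝ] (Fin (Module.finrank ℝ E) → ℝ) :=
    ContinuousLinearEquiv.ofFinrankEq (by simp)
  obtain ⟨z, h0, hz⟩ := exists_hasDerivWithinAt_Ici_pi
    ((Φ.lipschitz.comp hv).comp Φ.symm.lipschitz) (Φ z₀)
  refine ⟨fun t => Φ.symm (z t), by simp [h0], fun t ht => ?_⟩
  have := Φ.symm.hasFDerivAt.comp_hasDerivWithinAt t (hz t ht)
  simpa [Function.comp_def] using this

/-! ### Exponential decay and scalar comparison -/

/-- `f` decays exponentially on `[0, ∞)`. -/
def ExpDecay {E : Type*} [Norm E] (f : ℝ → E) : Prop :=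
  ∃ K d : ℝ, 0 ≤ K ∧ 0 < d ∧ ∀ t, 0 ≤ t → ‖f t‖ ≤ K * Real.exp (-(d * t))

theorem ExpDecay.of_norm_le {E F : Type*} [Norm E] [Norm F] {f : ℝ → E} {g : ℝ → F}
    (hf : ExpDecay f) {M : ℝ} (hM : 0 ≤ M) (h : ∀ t, 0 ≤ t → ‖g t‖ ≤ M * ‖f t‖) : ExpDecay g := by
  obtain ⟨K, d, hK, hd, hb⟩ := hf
  refine ⟨M * K, d, by positivity, hd, fun t ht => (h t ht).trans ?_⟩
  rw [mul_assoc]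
  gcongr
  exact hb t ht

theorem ExpDecay.add {E : Type*} [SeminormedAddCommGroup E] {f g : ℝ → E} (hf : ExpDecay f)
    (hg : ExpDecay g) : ExpDecay fun t => f t + g t := by
  obtain ⟨K, d, hK, hd, hb⟩ := hf
  obtain ⟨K', d', hK', hd', hb'⟩ := hg
  refine ⟨K + K', min d d', by positivity, lt_min hd hd', fun t ht => (norm_add_le _ _).trans ?_⟩
  rw [add_mul]
  gcongr
  · refine (hb t ht).trans ?_
    gcongr
    exact min_le_left _ _
  · refine (hb' t ht).trans ?_
    gcongr
    exact min_le_right _ _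

theorem ExpDecay.tendsto_zero {E : Type*} [SeminormedAddCommGroup E] {f : ℝ → E}
    (hf : ExpDecay f) : Tendsto f atTop (𝓝 0) := by
  obtain ⟨K, d, hK, hd, hb⟩ := hf
  refine squeeze_zero_norm' (a := fun t => K * Real.exp (-(d * t))) ?_ ?_
  · filter_upwards [eventually_ge_atTop 0] with t ht using hb t ht
  · have : Tendsto (fun t : ℝ => Real.exp (-(d * t))) atTop (𝓝 0) :=
      Real.tendsto_exp_neg_atTop_nhds_zero.comp (tendsto_id.const_mul_atTop hd)
    simpa using this.const_mul K

theorem ExpDecay.norm_pow_two {E : Type*} [SeminormedAddCommGroup E] {f : ℝ → E}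
    (hf : ExpDecay f) : ExpDecay fun t => ‖f t‖ ^ 2 := by
  obtain ⟨K, d, hK, hd, hb⟩ := hf
  refine ⟨K ^ 2, 2 * d, by positivity, by positivity, fun t ht => ?_⟩
  have : K ^ 2 * Real.exp (-(2 * d * t)) = (K * Real.exp (-(d * t))) ^ 2 := by
    rw [mul_pow, ← Real.exp_nat_mul]
    congr 2
    push_cast
    ring
  rw [this, norm_pow, norm_norm]
  exact pow_le_pow_left₀ (norm_nonneg _) (hb t ht) 2

theorem ExpDecay.of_norm_pow_two {E : Type*} [SeminormedAddCommGroup E] {f : ℝ → E}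
    (hf : ExpDecay fun t => ‖f t‖ ^ 2) : ExpDecay f := by
  obtain ⟨K, d, hK, hd, hb⟩ := hf
  refine ⟨√K, d / 2, by positivity, by positivity, fun t ht => ?_⟩
  have h := hb t ht
  refine le_of_sq_le_sq ?_ (by positivity)
  rw [mul_pow, Real.sq_sqrt hK, ← Real.exp_nat_mul]
  rw [norm_pow, norm_norm] at h
  have : ((2 : ℕ) : ℝ) * -(d / 2 * t) = -(d * t) := by push_cast; ring
  rwa [this]

/-- A nonnegative function with `U' ≤ -c U + h`, `h` exponentially decaying, decays
exponentially. -/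
theorem ExpDecay.of_deriv_le {U u h : ℝ → ℝ} {c : ℝ} (hc : 0 < c) (hU : ∀ t, 0 ≤ t → 0 ≤ U t)
    (hd : ∀ t, 0 ≤ t → HasDerivWithinAt U (u t) (Set.Ici 0) t)
    (hu : ∀ t, 0 ≤ t → u t ≤ -c * U t + h t) (hh : ExpDecay h) : ExpDecay U := by
  obtain ⟨K, d, hK, hd0, hb⟩ := hh
  -- A rate strictly below `d` avoids resonance with the forcing: the correction term has
  -- coefficient `K / (d - δ)`.
  obtain ⟨δ, hδ, hδc, hδd⟩ : ∃ δ, 0 < δ ∧ δ ≤ c ∧ δ < d :=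
    ⟨min c d / 2, by positivity, by linarith [min_le_left c d, lt_min hc hd0],
      by linarith [min_le_right c d, lt_min hc hd0]⟩
  have hdd : 0 < d - δ := by linarith
  have hder : ∀ t, 0 ≤ t → HasDerivWithinAt
      (fun t => Real.exp (δ * t) * U t + K / (d - δ) * Real.exp (-((d - δ) * t)))
      ((Real.exp (δ * t) * δ) * U t + Real.exp (δ * t) * u t
        + K / (d - δ) * (Real.exp (-((d - δ) * t)) * (-(d - δ)))) (Set.Ici 0) t := by
    intro t ht
    have e1 : HasDerivWithinAt (fun t => Real.exp (δ * t)) (Real.exp (δ * t) * δ) (Set.Ici 0) t := by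
      simpa using (((hasDerivAt_id t).const_mul δ).exp).hasDerivWithinAt
    have e2 : HasDerivWithinAt (fun t => Real.exp (-((d - δ) * t)))
        (Real.exp (-((d - δ) * t)) * (-(d - δ))) (Set.Ici 0) t := by
      simpa using ((((hasDerivAt_id t).const_mul (d - δ)).neg).exp).hasDerivWithinAt
    exact (e1.mul (hd t ht)).add (e2.const_mul _)
  have hanti : AntitoneOn
      (fun t => Real.exp (δ * t) * U t + K / (d - δ) * Real.exp (-((d - δ) * t))) (Set.Ici 0) := by
    refine antitoneOn_of_hasDerivWithinAt_nonpos (convex_Ici 0)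
      (fun t ht => (hder t ht).continuousWithinAt)
      (fun t ht => (hder t (interior_subset ht)).mono interior_subset) fun t ht => ?_
    have ht0 : 0 ≤ t := interior_subset ht
    have h1 : K / (d - δ) * (Real.exp (-((d - δ) * t)) * (-(d - δ)))
        = -(Real.exp (δ * t) * (K * Real.exp (-(d * t)))) := by
      have : Real.exp (-((d - δ) * t)) = Real.exp (δ * t) * Real.exp (-(d * t)) := by
        rw [← Real.exp_add]; congr 1; ring
      rw [this]; field_simp
    have h2 : h t ≤ K * Real.exp (-(d * t)) := (le_abs_self _).trans (hb t ht0)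
    have h3 : δ * U t + u t - K * Real.exp (-(d * t)) ≤ 0 := by
      nlinarith [hu t ht0, mul_le_mul_of_nonneg_right hδc (hU t ht0)]
    rw [h1]
    have := mul_nonpos_of_nonneg_of_nonpos (Real.exp_pos (δ * t)).le h3
    linarith
  refine ⟨U 0 + K / (d - δ), δ, add_nonneg (hU 0 le_rfl) (by positivity), hδ, fun t ht => ?_⟩
  have h1 := hanti (Set.mem_Ici.2 le_rfl) (Set.mem_Ici.2 ht) ht
  simp only [mul_zero, neg_zero, Real.exp_zero, one_mul, mul_one] at h1
  have h2 : 0 ≤ K / (d - δ) * Real.exp (-((d - δ) * t)) := by positivity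
  have h3 : Real.exp (δ * t) * U t ≤ U 0 + K / (d - δ) := by linarith
  rw [Real.norm_of_nonneg (hU t ht), Real.exp_neg, ← div_eq_mul_inv, le_div_iff₀ (Real.exp_pos _)]
  linarith

/-- A nonnegative function with `V' ≤ h (1 + V)`, `h` exponentially decaying, is bounded. -/
theorem exists_bound_of_deriv_le {V v h : ℝ → ℝ} (hV : ∀ t, 0 ≤ t → 0 ≤ V t)
    (hd : ∀ t, 0 ≤ t → HasDerivWithinAt V (v t) (Set.Ici 0) t)
    (hv : ∀ t, 0 ≤ t → v t ≤ h t * (1 + V t)) (hh : ExpDecay h) :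
    ∃ M, ∀ t, 0 ≤ t → V t ≤ M := by
  obtain ⟨K, d, hK, hd0, hb⟩ := hh
  -- An integrating factor with `E' = -K e^{-dt} E`. It stays between `1` and `E 0` for `t ≥ 0`,
  -- since the forcing has finite integral.
  set E : ℝ → ℝ := fun t => Real.exp (K / d * Real.exp (-(d * t)))
  have hE : ∀ t, HasDerivAt E (E t * (K / d * (Real.exp (-(d * t)) * (-d)))) t := fun t => by
    have : HasDerivAt (fun t => Real.exp (-(d * t))) (Real.exp (-(d * t)) * (-d)) t := by
      simpa using ((hasDerivAt_id t).const_mul d).neg.exp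
    exact (this.const_mul _).exp
  have hder : ∀ t, 0 ≤ t → HasDerivWithinAt (fun t => E t * (1 + V t))
      (E t * (K / d * (Real.exp (-(d * t)) * (-d))) * (1 + V t) + E t * v t) (Set.Ici 0) t :=
    fun t ht => (hE t).hasDerivWithinAt.mul ((hd t ht).const_add 1)
  have hanti : AntitoneOn (fun t => E t * (1 + V t)) (Set.Ici 0) := by
    refine antitoneOn_of_hasDerivWithinAt_nonpos (convex_Ici 0)
      (fun t ht => (hder t ht).continuousWithinAt)
      (fun t ht => (hder t (interior_subset ht)).mono interior_subset) fun t ht => ?_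
    have ht0 : 0 ≤ t := interior_subset ht
    have h1 : K / d * (Real.exp (-(d * t)) * (-d)) = -(K * Real.exp (-(d * t))) := by
      field_simp
    have h2 : h t ≤ K * Real.exp (-(d * t)) := (le_abs_self _).trans (hb t ht0)
    have h3 : v t - K * Real.exp (-(d * t)) * (1 + V t) ≤ 0 := by
      have := mul_le_mul_of_nonneg_right h2 (by linarith [hV t ht0] : 0 ≤ 1 + V t)
      linarith [hv t ht0]
    rw [h1]
    have := mul_nonpos_of_nonneg_of_nonpos (Real.exp_pos (K / d * Real.exp (-(d * t)))).le h3
    change E t * _ ≤ 0 at this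
    linarith
  refine ⟨E 0 * (1 + V 0), fun t ht => ?_⟩
  have h1 := hanti (Set.mem_Ici.2 le_rfl) (Set.mem_Ici.2 ht) ht
  have h2 : 1 ≤ E t := Real.one_le_exp (by positivity)
  have h3 : (1 : ℝ) * (1 + V t) ≤ E t * (1 + V t) :=
    mul_le_mul_of_nonneg_right h2 (by linarith [hV t ht])
  simp only at h1
  linarith

/-! ### Real quadratic forms -/

section Quadratic

variable {ι : Type*} [Fintype ι]

theorem exists_abs_dotProduct_mulVec_le (Q : Matrix ι ι ℝ) :
    ∃ M, 0 ≤ M ∧ ∀ x y : ι → ℝ, |x ⬝ᵥ Q *ᵥ y| ≤ M * (‖x‖ * ‖y‖) := by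
  refine ⟨∑ i, ∑ j, |Q i j|, by positivity, fun x y => ?_⟩
  simp only [dotProduct, Matrix.mulVec, Finset.mul_sum, Finset.sum_mul]
  refine (Finset.abs_sum_le_sum_abs _ _).trans (Finset.sum_le_sum fun i _ => ?_)
  refine (Finset.abs_sum_le_sum_abs _ _).trans (Finset.sum_le_sum fun j _ => ?_)
  rw [abs_mul, abs_mul]
  have h1 := norm_le_pi_norm x i
  have h2 := norm_le_pi_norm y j
  rw [Real.norm_eq_abs] at h1 h2
  calc |x i| * (|Q i j| * |y j|) = |Q i j| * (|x i| * |y j|) := by ring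
    _ ≤ _ := by gcongr

theorem exists_norm_mulVec_le {κ : Type*} [Fintype κ] (Q : Matrix κ ι ℝ) :
    ∃ M, 0 ≤ M ∧ ∀ x : ι → ℝ, ‖Q *ᵥ x‖ ≤ M * ‖x‖ := by
  refine ⟨‖(Matrix.mulVecLin Q).toContinuousLinearMap‖, norm_nonneg _, fun x => ?_⟩
  exact (Matrix.mulVecLin Q).toContinuousLinearMap.le_opNorm x

theorem dotProduct_mulVec_pos {Q : Matrix ι ι ℝ} (hQ : Q.PosDef) {x : ι → ℝ} (hx : x ≠ 0) :
    0 < x ⬝ᵥ Q *ᵥ x := by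
  simpa using hQ.dotProduct_mulVec_pos hx

theorem dotProduct_mulVec_nonneg {Q : Matrix ι ι ℝ} (hQ : Q.PosSemidef) (x : ι → ℝ) :
    0 ≤ x ⬝ᵥ Q *ᵥ x := by
  simpa using hQ.dotProduct_mulVec_nonneg x

theorem exists_coercive {Q : Matrix ι ι ℝ} (hQ : Q.PosDef) :
    ∃ ε, 0 < ε ∧ ∀ x : ι → ℝ, ε * ‖x‖ ^ 2 ≤ x ⬝ᵥ Q *ᵥ x := by
  have hcont : Continuous fun x : ι → ℝ => x ⬝ᵥ Q *ᵥ x := by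
    unfold dotProduct Matrix.mulVec dotProduct
    fun_prop
  have key : ∃ ε, 0 < ε ∧ ∀ x : ι → ℝ, ‖x‖ = 1 → ε ≤ x ⬝ᵥ Q *ᵥ x := by
    by_cases hne : (Metric.sphere (0 : ι → ℝ) 1).Nonempty
    · obtain ⟨x, hx, hmin⟩ := (isCompact_sphere (0 : ι → ℝ) 1).exists_isMinOn hne hcont.continuousOn
      refine ⟨_, dotProduct_mulVec_pos hQ (ne_zero_of_mem_unit_sphere ⟨x, hx⟩), fun y hy => ?_⟩
      exact hmin (by simpa using hy)
    -- The unit sphere is empty only for an empty index type; any positive constant serves.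
    · exact ⟨1, one_pos, fun x hx => absurd ⟨x, by simpa using hx⟩ hne⟩
  obtain ⟨ε, hε, h⟩ := key
  refine ⟨ε, hε, fun x => ?_⟩
  by_cases hx : x = 0
  · simp [hx]
  · have hn : ‖x‖ ≠ 0 := by simpa using hx
    have := h (‖x‖⁻¹ • x) (by rw [norm_smul, norm_inv, norm_norm, inv_mul_cancel₀ hn])
    rw [Matrix.mulVec_smul, smul_dotProduct, dotProduct_smul, smul_eq_mul, smul_eq_mul] at this
    have h2 := mul_le_mul_of_nonneg_right this (sq_nonneg ‖x‖)
    calc ε * ‖x‖ ^ 2 ≤ _ := h2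
      _ = _ := by field_simp

theorem dotProduct_mulVec_comm {Q : Matrix ι ι ℝ} (hQ : Q.IsHermitian) (x y : ι → ℝ) :
    x ⬝ᵥ Q *ᵥ y = y ⬝ᵥ Q *ᵥ x := by
  rw [Matrix.dotProduct_mulVec, ← Matrix.mulVec_transpose, dotProduct_comm]
  rw [← Matrix.conjTranspose_eq_transpose_of_trivial, hQ.eq]

theorem dotProduct_lyapunov {Q : Matrix ι ι ℝ} (hQ : Q.IsHermitian) (A : Matrix ι ι ℝ) (x : ι → ℝ) :
    x ⬝ᵥ (Q * A + Aᵀ * Q) *ᵥ x = 2 * (x ⬝ᵥ Q *ᵥ (A *ᵥ x)) := by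
  rw [Matrix.add_mulVec, dotProduct_add, ← Matrix.mulVec_mulVec, ← Matrix.mulVec_mulVec,
    Matrix.dotProduct_mulVec x Aᵀ, Matrix.vecMul_transpose, dotProduct_mulVec_comm hQ (A *ᵥ x),
    two_mul]

theorem two_mul_dotProduct_mulVec_le {Q : Matrix ι ι ℝ} (hQ : Q.PosDef) {c : ℝ} (hc : 0 < c)
    (x y : ι → ℝ) : 2 * (x ⬝ᵥ Q *ᵥ y) ≤ c * (x ⬝ᵥ Q *ᵥ x) + c⁻¹ * (y ⬝ᵥ Q *ᵥ y) := by
  have h := dotProduct_mulVec_nonneg hQ.posSemidef (c • x - y)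
  simp only [Matrix.mulVec_sub, Matrix.mulVec_smul, sub_dotProduct, smul_dotProduct,
    dotProduct_sub, dotProduct_smul, smul_eq_mul, dotProduct_mulVec_comm hQ.isHermitian y x] at h
  have h2 := mul_nonneg (inv_pos.2 hc).le h
  have h3 : c⁻¹ * (c * (c * (x ⬝ᵥ Q *ᵥ x) - x ⬝ᵥ Q *ᵥ y) - (c * (x ⬝ᵥ Q *ᵥ y) - y ⬝ᵥ Q *ᵥ y))
      = c * (x ⬝ᵥ Q *ᵥ x) + c⁻¹ * (y ⬝ᵥ Q *ᵥ y) - 2 * (x ⬝ᵥ Q *ᵥ y) := by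
    field_simp; ring
  linarith

theorem hasDerivWithinAt_quadratic {Q : Matrix ι ι ℝ} (hQ : Q.IsHermitian) {z : ℝ → ι → ℝ}
    {z' : ι → ℝ} {s : Set ℝ} {t : ℝ} (hz : HasDerivWithinAt z z' s t) :
    HasDerivWithinAt (fun t => z t ⬝ᵥ Q *ᵥ z t) (2 * (z t ⬝ᵥ Q *ᵥ z')) s t := by
  have h1 := hasDerivWithinAt_pi.1 hz
  have h2 : HasDerivWithinAt (fun t => z t ⬝ᵥ Q *ᵥ z t)
      (∑ i, (z' i * (∑ j, Q i j * z t j) + z t i * ∑ j, Q i j * z' j)) s t := by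
    unfold dotProduct Matrix.mulVec dotProduct
    exact HasDerivWithinAt.fun_sum fun i _ =>
      (h1 i).mul (HasDerivWithinAt.fun_sum fun j _ => (h1 j).const_mul (Q i j))
  convert h2 using 1
  rw [Finset.sum_add_distrib, two_mul]
  nth_rewrite 1 [dotProduct_mulVec_comm hQ]
  rfl

/-- An exponentially decaying input yields an exponentially decaying state if the linear system
has a strict quadratic Lyapunov function. -/
theorem ExpDecay.of_lyapunov {H Q : Matrix ι ι ℝ} (hQ : Q.PosDef) {c : ℝ} (hc : 0 < c)
    (hH : ∀ x, x ⬝ᵥ Q *ᵥ (H *ᵥ x) ≤ -c * (x ⬝ᵥ Q *ᵥ x)) {z f : ℝ → ι → ℝ}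
    (hz : ∀ t, 0 ≤ t → HasDerivWithinAt z (H *ᵥ z t + f t) (Set.Ici 0) t) (hf : ExpDecay f) :
    ExpDecay z := by
  obtain ⟨M, hM, hMb⟩ := exists_abs_dotProduct_mulVec_le Q
  obtain ⟨ε, hε, hεb⟩ := exists_coercive hQ
  have hU : ExpDecay fun t => z t ⬝ᵥ Q *ᵥ z t := by
    refine ExpDecay.of_deriv_le hc (fun t _ => dotProduct_mulVec_nonneg hQ.posSemidef _)
      (fun t ht => hasDerivWithinAt_quadratic hQ.isHermitian (hz t ht))
      (h := fun t => c⁻¹ * (f t ⬝ᵥ Q *ᵥ f t)) (fun t _ => ?_) ?_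
    · rw [Matrix.mulVec_add, dotProduct_add]
      linarith [hH (z t), two_mul_dotProduct_mulVec_le hQ hc (z t) (f t)]
    · refine hf.norm_pow_two.of_norm_le (M := c⁻¹ * M) (by positivity) fun t _ => ?_
      rw [norm_mul, Real.norm_of_nonneg (inv_pos.2 hc).le, norm_pow, norm_norm, mul_assoc, sq]
      gcongr
      exact hMb _ _
  refine ExpDecay.of_norm_pow_two (hU.of_norm_le (M := ε⁻¹) (by positivity) fun t _ => ?_)
  rw [norm_pow, norm_norm, Real.norm_of_nonneg (dotProduct_mulVec_nonneg hQ.posSemidef _),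
    inv_mul_eq_div, le_div_iff₀ hε]
  linarith [hεb (z t)]

end Quadratic

/-! ### Lyapunov functions for complex endomorphisms -/

/-- `b` is a real inner product on the complex vector space `E`. -/
structure IsRealInner {E : Type*} [AddCommGroup E] [Module ℂ E] (b : E → E → ℝ) : Prop where
  add_left : ∀ x y z, b (x + y) z = b x z + b y z
  smul_left : ∀ (c : ℝ) x y, b ((c : ℂ) • x) y = c * b x y
  symm : ∀ x y, b x y = b y x
  pos : ∀ x, x ≠ 0 → 0 < b x x

namespace IsRealInner

variable {E : Type*} [AddCommGroup E] [Module ℂ E] {b : E → E → ℝ}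

theorem add_right (hb : IsRealInner b) (x y z : E) : b x (y + z) = b x y + b x z := by
  rw [hb.symm, hb.add_left, hb.symm y, hb.symm z]

theorem smul_right (hb : IsRealInner b) (c : ℝ) (x y : E) : b x ((c : ℂ) • y) = c * b x y := by
  rw [hb.symm, hb.smul_left, hb.symm]

theorem zero_left (hb : IsRealInner b) (y : E) : b 0 y = 0 := by
  simpa using hb.smul_left 0 0 y

theorem neg_right (hb : IsRealInner b) (x y : E) : b x (-y) = -b x y := by
  simpa using hb.smul_right (-1) x y

theorem nonneg (hb : IsRealInner b) (x : E) : 0 ≤ b x x := by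
  by_cases hx : x = 0
  · rw [hx, hb.zero_left]
  · exact (hb.pos x hx).le

theorem two_mul_le (hb : IsRealInner b) {c : ℝ} (hc : 0 < c) (x y : E) :
    2 * b x y ≤ c * b x x + c⁻¹ * b y y := by
  have h := hb.nonneg ((c : ℂ) • x + (-y))
  simp only [hb.add_left, hb.add_right, hb.smul_left, hb.smul_right, hb.neg_right,
    hb.symm (-y)] at h
  have h2 := mul_nonneg (inv_pos.2 hc).le h
  have h3 : c⁻¹ * (c * (c * b x x) + c * -b x y + (c * -b x y + - -b y y))
      = c * b x x + c⁻¹ * b y y - 2 * b x y := by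
    field_simp; ring
  linarith

/-- A form that is bilinear only over `ℝ` need not make complex scalars act conformally; expanding
`z = re + im I` still bounds their effect by a fixed multiple of `|z|²`. -/
theorem smul_smul_le (hb : IsRealInner b) (z : ℂ) (x : E) :
    b (z • x) (z • x) ≤ 2 * (b x x + b (Complex.I • x) (Complex.I • x)) * Complex.normSq z := by
  have hz : z • x = (z.re : ℂ) • x + (z.im : ℂ) • (Complex.I • x) := by
    rw [smul_smul, ← add_smul, Complex.re_add_im]
  have h := hb.two_mul_le one_pos ((z.re : ℂ) • x) ((z.im : ℂ) • (Complex.I • x))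
  rw [hz, Complex.normSq_apply]
  simp only [hb.add_left, hb.add_right, hb.smul_left, hb.smul_right] at h ⊢
  rw [hb.symm (Complex.I • x) x]
  have h1 := mul_nonneg (hb.nonneg x) (mul_self_nonneg z.im)
  have h2 := mul_nonneg (hb.nonneg (Complex.I • x)) (mul_self_nonneg z.re)
  linarith

/-- A real inner product for which multiplication by imaginary numbers is skew. -/
theorem exists_skew (hb : IsRealInner b) : ∃ b' : E → E → ℝ, IsRealInner b' ∧
    ∀ (μ : ℂ) x, μ.re = 0 → b' x (μ • x) = 0 := by
  -- Averaging over multiplication by `I` makes `I` an isometry. Since `I² = -1`, it is then skew.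
  refine ⟨fun x y => b x y + b (Complex.I • x) (Complex.I • y), ⟨fun x y z => ?_, fun c x y => ?_,
    fun x y => ?_, fun x hx => ?_⟩, fun μ x hμ => ?_⟩
  · rw [smul_add, hb.add_left, hb.add_left]; ring
  · rw [smul_comm, hb.smul_left, hb.smul_left]; ring
  · rw [hb.symm, hb.symm (Complex.I • x)]
  · exact add_pos_of_pos_of_nonneg (hb.pos x hx) (hb.nonneg _)
  · have hm : μ • x = (μ.im : ℂ) • (Complex.I • x) := by
      rw [smul_smul]
      congr 1
      exact Complex.ext (by simp [hμ]) (by simp)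
    have hI : Complex.I • (Complex.I • x) = -x := by
      rw [smul_smul, Complex.I_mul_I, neg_one_smul]
    simp only
    rw [hm, smul_comm Complex.I, hI, hb.smul_right, hb.smul_right, hb.neg_right,
      hb.symm (Complex.I • x)]
    ring

end IsRealInner

/-- Induction along an invariant hyperplane, the kernel of an eigenvector `φ` of the dual map. The
form on the hyperplane is extended by a large multiple of `|φ|²`, which absorbs the coupling between
hyperplane and quotient. This replaces the matrix exponential and triangularization. -/
theorem exists_strict_lyapunov (d : ℕ) : ∀ (E : Type) [AddCommGroup E] [Module ℂ E]
    [FiniteDimensional ℂ E] (T : Module.End ℂ E), Module.finrank ℂ E = d →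
    (∀ μ, T.HasEigenvalue μ → μ.re < 0) →
    ∃ (b : E → E → ℝ) (c : ℝ), 0 < c ∧ IsRealInner b ∧ ∀ x, b x (T x) ≤ -c * b x x := by
  induction d with
  | zero =>
    intro E _ _ _ T hd _
    have : Subsingleton E := Module.finrank_zero_iff.1 hd
    exact ⟨fun _ _ => 0, 1, one_pos, ⟨by simp, by simp, by simp,
      fun x hx => absurd (Subsingleton.elim x 0) hx⟩, by simp⟩
  | succ d ih =>
    intro E _ _ _ T hd hT
    have : Nontrivial E := Module.nontrivial_of_finrank_pos (R := ℂ) (by omega)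
    obtain ⟨l, hl⟩ := Module.End.exists_eigenvalue
      (show Module.End ℂ (Module.Dual ℂ E) from T.dualMap)
    obtain ⟨φ, hφ⟩ := hl.exists_hasEigenvector
    have hφT : ∀ x, φ (T x) = l * φ x := fun x => by
      have := LinearMap.congr_fun hφ.apply_eq_smul x
      simpa using this
    obtain ⟨u, hu⟩ : ∃ u, φ u = 1 := by
      obtain ⟨v, hv⟩ : ∃ v, φ v ≠ 0 := by
        by_contra! h
        exact hφ.2 (LinearMap.ext h)
      exact ⟨(φ v)⁻¹ • v, by simp [hv]⟩
    -- An eigenvalue of the dual map is one of `T`: otherwise `T - l` would be onto, while `φ`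
    -- vanishes on its range and `φ u = 1`.
    have hre : l.re < 0 := by
      refine hT l fun hbot => ?_
      replace hbot : T.eigenspace l = ⊥ := hbot
      rw [Module.End.eigenspace_def] at hbot
      obtain ⟨v, hv⟩ := LinearMap.surjective_of_injective (LinearMap.ker_eq_bot.1 hbot) u
      have : φ u = 0 := by rw [← hv]; simp [hφT]
      rw [hu] at this
      exact one_ne_zero this
    set W := LinearMap.ker φ with hW
    have hWT : ∀ x ∈ W, T x ∈ W := fun x hx => by
      rw [hW, LinearMap.mem_ker] at hx ⊢
      rw [hφT, hx, mul_zero]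
    have hWd : Module.finrank ℂ W = d := by
      have h1 := LinearMap.finrank_range_add_finrank_ker φ
      have h2 : LinearMap.range φ = ⊤ :=
        LinearMap.range_eq_top.2 fun z => ⟨z • u, by simp [hu]⟩
      rw [h2, finrank_top, Module.finrank_self, ← hW] at h1
      omega
    obtain ⟨bW, c, hc, hbW, hbT⟩ := ih W (T.restrict hWT) hWd fun μ hμ => by
      obtain ⟨v, hv⟩ := hμ.exists_hasEigenvector
      refine hT μ (Module.End.hasEigenvalue_of_hasEigenvector (x := (v : E)) ⟨?_, ?_⟩)
      · rw [Module.End.mem_eigenspace_iff]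
        exact congrArg Subtype.val hv.apply_eq_smul
      · exact fun h => hv.2 (Subtype.ext h)
    let p : E →ₗ[ℂ] W := LinearMap.codRestrict W (LinearMap.id - φ.smulRight u) fun x => by
      simp [hW, hu]
    have hp : ∀ x, (p x : E) = x - φ x • u := fun x => rfl
    let w₀ : W := ⟨T u - l • u, by simp [hW, hu, hφT]⟩
    -- The projection along `u` fails to commute with `T` only by the rank-one coupling `φ x • w₀`.
    have hpT : ∀ x, p (T x) = T.restrict hWT (p x) + φ x • w₀ := fun x => by
      apply Subtype.ext
      rw [Submodule.coe_add, LinearMap.coe_restrict_apply, hp, hp, hφT, map_sub, map_smul,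
        Submodule.coe_smul]
      change _ = T x - φ x • T u + φ x • (T u - l • u)
      rw [smul_sub, smul_smul, mul_comm]
      abel
    set M := 2 * (bW w₀ w₀ + bW (Complex.I • w₀) (Complex.I • w₀)) with hM
    have hM0 : 0 ≤ M := by have := hbW.nonneg w₀; have := hbW.nonneg (Complex.I • w₀); positivity
    -- Chosen so that `k * l.re = -(c⁻¹ M + 1)`: this cancels the coupling, bounded by `c⁻¹ M |φ
    -- x|²`, and leaves at least `|φ x|²` of decrease.
    set k := (c⁻¹ * M + 1) / (-l.re) with hk
    have hl0 : 0 < -l.re := by linarith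
    have hk0 : 0 < k := by positivity
    have hkl : k * l.re = -(c⁻¹ * M + 1) := by
      have : l.re ≠ 0 := hre.ne
      rw [hk]; field_simp
    refine ⟨fun x y => bW (p x) (p y) + k * ((φ x).re * (φ y).re + (φ x).im * (φ y).im),
      min (c / 2) k⁻¹, by positivity, ⟨fun x y z => ?_, fun r x y => ?_, fun x y => ?_,
      fun x hx => ?_⟩, fun x => ?_⟩
    · simp only [map_add, hbW.add_left, Complex.add_re, Complex.add_im]; ring
    · simp only [map_smul, hbW.smul_left, smul_eq_mul, Complex.re_ofReal_mul,
        Complex.im_ofReal_mul]; ring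
    · simp only [hbW.symm (p x) (p y)]; ring
    · by_cases hφx : φ x = 0
      · have : p x ≠ 0 := fun h => hx (by
          have := hp x
          rw [h, hφx] at this
          simpa using this.symm)
        simpa [hφx] using hbW.pos _ this
      · have := Complex.normSq_pos.2 hφx
        rw [Complex.normSq_apply] at this
        exact add_pos_of_nonneg_of_pos (hbW.nonneg _) (mul_pos hk0 this)
    · simp only [hpT, hbW.add_right, hφT, Complex.mul_re, Complex.mul_im]
      have h1 := hbT (p x)
      have h2 := hbW.two_mul_le hc (p x) (φ x • w₀)
      have h3 := mul_le_mul_of_nonneg_left (hbW.smul_smul_le (φ x) w₀) (inv_pos.2 hc).le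
      rw [← hM, Complex.normSq_apply] at h3
      set s := (φ x).re * (φ x).re + (φ x).im * (φ x).im with hs
      have hs0 : 0 ≤ s := add_nonneg (mul_self_nonneg _) (mul_self_nonneg _)
      have h4 : k * ((φ x).re * (l.re * (φ x).re - l.im * (φ x).im)
          + (φ x).im * (l.re * (φ x).im + l.im * (φ x).re)) = -(c⁻¹ * M + 1) * s := by
        rw [← hkl, hs]; ring
      rw [h4]
      have h5 : min (c / 2) k⁻¹ * bW (p x) (p x) ≤ c / 2 * bW (p x) (p x) :=
        mul_le_mul_of_nonneg_right (min_le_left _ _) (hbW.nonneg _)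
      have h6 : min (c / 2) k⁻¹ * (k * s) ≤ s := by
        calc _ ≤ k⁻¹ * (k * s) := mul_le_mul_of_nonneg_right (min_le_right _ _) (by positivity)
          _ = s := by field_simp
      have h7 : 0 ≤ c⁻¹ * M * s := by positivity
      have h8 : c⁻¹ * (M * s) = c⁻¹ * M * s := by ring
      linarith

/-- A strict Lyapunov form for `-1` is in particular an inner product, so no basis has to be chosen.
-/
theorem exists_isRealInner (E : Type) [AddCommGroup E] [Module ℂ E] [FiniteDimensional ℂ E] :
    ∃ b : E → E → ℝ, IsRealInner b := by
  obtain ⟨b, -, -, hb, -⟩ := exists_strict_lyapunov _ E (-1) rfl fun μ hμ => by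
    obtain ⟨v, hv⟩ := hμ.exists_hasEigenvector
    have h : -v = μ • v := hv.apply_eq_smul
    have : (μ + 1) • v = 0 := by rw [add_smul, ← h]; simp
    have h1 : μ = -1 := eq_neg_of_add_eq_zero_left ((smul_eq_zero.1 this).resolve_right hv.2)
    simp [h1]
  exact ⟨b, hb⟩

/-- Semisimplicity splits off an imaginary eigenvalue `μ`: the space is the direct sum of kernel and
range of `T - μ`. On the kernel `T` is multiplication by `μ`, which is skew for a suitable inner
product; the range has smaller dimension and is handled by induction. Once no imaginary eigenvalue
is left, the strict form applies. -/
theorem exists_lyapunov (d : ℕ) : ∀ (E : Type) [AddCommGroup E] [Module ℂ E]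
    [FiniteDimensional ℂ E] (T : Module.End ℂ E), Module.finrank ℂ E = d →
    (∀ μ, T.HasEigenvalue μ → μ.re ≤ 0 ∧ (μ.re = 0 → T.maxGenEigenspace μ = T.eigenspace μ)) →
    ∃ b : E → E → ℝ, IsRealInner b ∧ ∀ x, b x (T x) ≤ 0 := by
  induction d using Nat.strong_induction_on with
  | _ d ih =>
    intro E _ _ _ T hd hT
    by_cases hneg : ∀ μ, T.HasEigenvalue μ → μ.re < 0
    · obtain ⟨b, c, hc, hb, h⟩ := exists_strict_lyapunov d E T hd hneg
      exact ⟨b, hb, fun x => (h x).trans (by have := hb.nonneg x; nlinarith)⟩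
    push Not at hneg
    obtain ⟨μ, hμ, hμ0⟩ := hneg
    have hre : μ.re = 0 := le_antisymm (hT μ hμ).1 hμ0
    set S : Module.End ℂ E := T - algebraMap ℂ (Module.End ℂ E) μ with hS
    have hSa : ∀ x, S x = T x - μ • x := fun x => by simp [hS]
    have hker : LinearMap.ker S = T.eigenspace μ := Module.End.eigenspace_def.symm
    have hdisj : Disjoint (LinearMap.ker S) (LinearMap.range S) := by
      rw [Submodule.disjoint_def]
      rintro _ hx ⟨y, rfl⟩
      -- From `S (S y) = 0`, `y` is a generalized eigenvector, hence an eigenvector, so `S y = 0`.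
      have hy : y ∈ T.maxGenEigenspace μ := by
        rw [Module.End.mem_maxGenEigenspace]
        refine ⟨2, ?_⟩
        rw [pow_two]
        simpa [hSa] using hx
      rw [(hT μ hμ).2 hre, ← hker] at hy
      exact hy
    have hcompl : IsCompl (LinearMap.ker S) (LinearMap.range S) := by
      refine ⟨hdisj, codisjoint_iff.2 (Submodule.eq_top_of_finrank_eq ?_)⟩
      have h1 := Submodule.finrank_sup_add_finrank_inf_eq (LinearMap.ker S) (LinearMap.range S)
      rw [hdisj.eq_bot, finrank_bot] at h1
      have h2 := LinearMap.finrank_range_add_finrank_ker S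
      omega
    set W := LinearMap.range S with hW
    have hWT : ∀ x ∈ W, T x ∈ W := by
      rintro _ ⟨y, rfl⟩
      exact ⟨T y, by simp [hSa]⟩
    have hWd : Module.finrank ℂ W < d := by
      have h2 := LinearMap.finrank_range_add_finrank_ker S
      rw [← hW] at h2
      have h3 : 0 < Module.finrank ℂ (LinearMap.ker S) := by
        rw [Module.finrank_pos_iff, Submodule.nontrivial_iff_ne_bot, hker]
        exact hμ
      omega
    obtain ⟨bW, hbW, hbT⟩ := ih _ hWd W (T.restrict hWT) rfl fun ν hν => by
      have hν' : T.HasEigenvalue ν := by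
        obtain ⟨v, hv⟩ := hν.exists_hasEigenvector
        refine Module.End.hasEigenvalue_of_hasEigenvector (x := (v : E)) ⟨?_, ?_⟩
        · rw [Module.End.mem_eigenspace_iff]
          exact congrArg Subtype.val hv.apply_eq_smul
        · exact fun h => hv.2 (Subtype.ext h)
      refine ⟨(hT ν hν').1, fun h0 => le_antisymm (fun x hx => ?_) ?_⟩
      · rw [Module.End.mem_maxGenEigenspace] at hx
        obtain ⟨k, hk⟩ := hx
        have hpow : ∀ (k : ℕ) (y : W), (((T.restrict hWT - ν • 1) ^ k) y : E)
            = ((T - ν • (1 : Module.End ℂ E)) ^ k) y := by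
          intro k
          induction k with
          | zero => simp
          | succ k ihk =>
            intro y
            rw [pow_succ, pow_succ, Module.End.mul_apply, Module.End.mul_apply, ihk]
            simp
        have hx' : (x : E) ∈ T.maxGenEigenspace ν := by
          rw [Module.End.mem_maxGenEigenspace]
          exact ⟨k, by rw [← hpow, hk]; rfl⟩
        rw [(hT ν hν').2 h0, Module.End.mem_eigenspace_iff] at hx'
        rw [Module.End.mem_eigenspace_iff]
        exact Subtype.ext hx'
      · intro x hx
        rw [Module.End.mem_maxGenEigenspace]
        rw [Module.End.mem_eigenspace_iff] at hx
        exact ⟨1, by simp [hx]⟩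
    obtain ⟨b₀, hb₀⟩ := exists_isRealInner (LinearMap.ker S)
    obtain ⟨bK, hbK, hskew⟩ := hb₀.exists_skew
    let e := Submodule.prodEquivOfIsCompl _ _ hcompl
    have he : ∀ x, T (e x) = e (μ • x.1, T.restrict hWT x.2) := by
      rintro ⟨x, y⟩
      have hx : T x = μ • (x : E) := by
        have := hSa x
        rw [LinearMap.mem_ker.1 x.2] at this
        exact (sub_eq_zero.1 this.symm)
      simp [e, hx]
    have he' : ∀ x, e.symm (T x) = (μ • (e.symm x).1, T.restrict hWT (e.symm x).2) := fun x => by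
      rw [LinearEquiv.symm_apply_eq, ← he, LinearEquiv.apply_symm_apply]
    refine ⟨fun x y => bK (e.symm x).1 (e.symm y).1 + bW (e.symm x).2 (e.symm y).2,
      ⟨fun x y z => ?_, fun c x y => ?_, fun x y => ?_, fun x hx => ?_⟩, fun x => ?_⟩
    · simp only [map_add, Prod.fst_add, Prod.snd_add, hbK.add_left, hbW.add_left]; ring
    · simp only [map_smul, Prod.smul_fst, Prod.smul_snd, hbK.smul_left, hbW.smul_left]; ring
    · rw [hbK.symm, hbW.symm]
    · have hx' : e.symm x ≠ 0 := by simpa using hx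
      by_cases h1 : (e.symm x).1 = 0
      · have h2 : (e.symm x).2 ≠ 0 := fun h2 => hx' (Prod.ext h1 h2)
        exact add_pos_of_nonneg_of_pos (hbK.nonneg _) (hbW.pos _ h2)
      · exact add_pos_of_pos_of_nonneg (hbK.pos _ h1) (hbW.nonneg _)
    · simp only [he', hskew μ _ hre, zero_add]
      exact hbT _

/-! ### Lyapunov matrices -/

section LyapunovMatrix

variable {ι : Type} [Fintype ι] [DecidableEq ι]

/-- The Gram matrix of a real inner product on `ℂ^ι` in the standard basis. -/
theorem IsRealInner.exists_posDef {b : (ι → ℂ) → (ι → ℂ) → ℝ} (hb : IsRealInner b) :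
    ∃ Q : Matrix ι ι ℝ, Q.PosDef ∧ ∀ x y : ι → ℝ,
      x ⬝ᵥ Q *ᵥ y = b (fun i => (x i : ℂ)) (fun i => (y i : ℂ)) := by
  have hsum_left : ∀ (s : Finset ι) (f : ι → ι → ℂ) y, b (∑ i ∈ s, f i) y = ∑ i ∈ s, b (f i) y := by
    intro s f y
    induction s using Finset.cons_induction with
    | empty => simp [hb.zero_left]
    | cons a s ha ih => rw [Finset.sum_cons, Finset.sum_cons, hb.add_left, ih]
  have hsum_right : ∀ (s : Finset ι) (f : ι → ι → ℂ) y, b y (∑ i ∈ s, f i) = ∑ i ∈ s, b y (f i) := by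
    intro s f y
    rw [hb.symm, hsum_left]
    exact Finset.sum_congr rfl fun i _ => hb.symm _ _
  let e : ι → ι → ℂ := fun i => Pi.single i 1
  have hexp : ∀ x : ι → ℝ, (fun i => (x i : ℂ)) = ∑ i, (x i : ℂ) • e i := fun x => by
    funext j
    simp [e, Finset.sum_apply, Pi.single_apply]
  have hQ : ∀ x y : ι → ℝ, x ⬝ᵥ (Matrix.of fun i j => b (e i) (e j)) *ᵥ y
      = b (fun i => (x i : ℂ)) (fun i => (y i : ℂ)) := by
    intro x y
    rw [hexp x, hexp y, hsum_left]
    simp only [dotProduct, Matrix.mulVec, Matrix.of_apply, hsum_right, hb.smul_left, hb.smul_right]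
    refine Finset.sum_congr rfl fun i _ => ?_
    rw [Finset.mul_sum]
    exact Finset.sum_congr rfl fun j _ => by ring
  refine ⟨Matrix.of fun i j => b (e i) (e j), ?_, hQ⟩
  refine Matrix.PosDef.of_dotProduct_mulVec_pos ?_ fun x hx => ?_
  · ext i j
    simp [hb.symm (e i) (e j)]
  · rw [star_trivial, hQ]
    refine hb.pos _ fun h => hx (funext fun i => ?_)
    simpa using congrFun h i

theorem toLin'_map_ofReal (H : Matrix ι ι ℝ) (x : ι → ℝ) :
    Matrix.toLin' (H.map (algebraMap ℝ ℂ)) (fun i => (x i : ℂ)) = fun i => ((H *ᵥ x) i : ℂ) := by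
  funext i
  simp [Matrix.mulVec, dotProduct]

/-- A real matrix preserves the real vectors in `ℂ^ι`, so the form on `ℂ^ι` may simply be restricted
to them. -/
theorem exists_strict_lyapunov_matrix (H : Matrix ι ι ℝ)
    (hH : ∀ μ : ℂ, Module.End.HasEigenvalue (Matrix.toLin' (H.map (algebraMap ℝ ℂ))) μ → μ.re < 0) :
    ∃ (Q : Matrix ι ι ℝ) (c : ℝ), Q.PosDef ∧ 0 < c ∧
      ∀ x, x ⬝ᵥ Q *ᵥ (H *ᵥ x) ≤ -c * (x ⬝ᵥ Q *ᵥ x) := by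
  obtain ⟨b, c, hc, hb, hbT⟩ := exists_strict_lyapunov _ (ι → ℂ) _ rfl hH
  obtain ⟨Q, hQ, hQb⟩ := hb.exists_posDef
  refine ⟨Q, c, hQ, hc, fun x => ?_⟩
  rw [hQb, hQb, ← toLin'_map_ofReal]
  exact hbT _

theorem exists_isLyapunovMatrix {n : ℕ} {A : Matrix (Fin n) (Fin n) ℝ} (hA : IsNeutrallyStable A) :
    ∃ P, IsLyapunovMatrix A P := by
  obtain ⟨b, hb, hbT⟩ := exists_lyapunov _ (Fin n → ℂ) _ rfl hA
  obtain ⟨Q, hQ, hQb⟩ := hb.exists_posDef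
  refine ⟨Q, hQ, Matrix.PosSemidef.of_dotProduct_mulVec_nonneg ?_ fun x => ?_⟩
  · have h := hQ.isHermitian.eq
    rw [Matrix.conjTranspose_eq_transpose_of_trivial] at h
    rw [Matrix.IsHermitian, Matrix.conjTranspose_eq_transpose_of_trivial, Matrix.transpose_neg,
      Matrix.transpose_add, Matrix.transpose_mul, Matrix.transpose_mul, Matrix.transpose_transpose,
      h, add_comm]
  · have := hbT fun i => (x i : ℂ)
    rw [complexify, toLin'_map_ofReal, ← hQb] at this
    rw [star_trivial, Matrix.neg_mulVec, dotProduct_neg, dotProduct_lyapunov hQ.isHermitian]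
    linarith

theorem IsLyapunovMatrix.dotProduct_nonpos {n : ℕ} {A P : Matrix (Fin n) (Fin n) ℝ}
    (hP : IsLyapunovMatrix A P) (x : Fin n → ℝ) : x ⬝ᵥ P *ᵥ (A *ᵥ x) ≤ 0 := by
  have := dotProduct_mulVec_nonneg hP.2 x
  rw [Matrix.neg_mulVec, dotProduct_neg, dotProduct_lyapunov hP.1.isHermitian] at this
  linarith

end LyapunovMatrix

/-! ### Hurwitz matrices -/

/-- Real and imaginary parts of a complex eigenvector of a real matrix. -/
theorem exists_real_imag_eigenvector {n : ℕ} {H : Matrix (Fin n) (Fin n) ℝ} {μ : ℂ}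
    (hμ : (complexify H).HasEigenvalue μ) :
    ∃ a b : Fin n → ℝ, ¬ (a = 0 ∧ b = 0) ∧ H *ᵥ a = μ.re • a + (-μ.im) • b ∧
      H *ᵥ b = μ.im • a + μ.re • b := by
  obtain ⟨v, hv⟩ := hμ.exists_hasEigenvector
  have h : ∀ i, ∑ j, (H i j : ℂ) * v j = μ * v i := fun i => by
    have := congrFun hv.apply_eq_smul i
    simpa [complexify, Matrix.mulVec, dotProduct] using this
  refine ⟨fun i => (v i).re, fun i => (v i).im, fun h0 => hv.2 (funext fun i =>
    Complex.ext (congrFun h0.1 i) (congrFun h0.2 i)), funext fun i => ?_, funext fun i => ?_⟩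
  · have := congrArg Complex.re (h i)
    simp only [Complex.re_sum, Complex.re_ofReal_mul] at this
    rw [Complex.mul_re] at this
    simp only [Matrix.mulVec, dotProduct, Pi.add_apply, Pi.smul_apply, smul_eq_mul]
    linarith
  · have := congrArg Complex.im (h i)
    simp only [Complex.im_sum, Complex.im_ofReal_mul] at this
    rw [Complex.mul_im] at this
    simp only [Matrix.mulVec, dotProduct, Pi.add_apply, Pi.smul_apply, smul_eq_mul]
    linarith

/-- The span of `x` and `y` is `M`-invariant and lies in the kernel of `D`. This is the eigenvector
test for observability and controllability, with real and imaginary parts in place of a complex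
eigenvector. -/
theorem mulVec_pow_eq_zero {n q : ℕ} {M : Matrix (Fin n) (Fin n) ℝ} {D : Matrix (Fin q) (Fin n) ℝ}
    {x y : Fin n → ℝ} {s t s' t' : ℝ} (hx : M *ᵥ x = s • x + t • y) (hy : M *ᵥ y = s' • x + t' • y)
    (hDx : D *ᵥ x = 0) (hDy : D *ᵥ y = 0) (k : ℕ) :
    (D * M ^ k) *ᵥ x = 0 ∧ (D * M ^ k) *ᵥ y = 0 := by
  induction k with
  | zero => simp [hDx, hDy]
  | succ k ih =>
    rw [pow_succ, ← Matrix.mul_assoc, ← Matrix.mulVec_mulVec x, ← Matrix.mulVec_mulVec y, hx, hy]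
    simp only [Matrix.mulVec_add, Matrix.mulVec_smul, ih.1, ih.2, smul_zero, add_zero, and_self]

theorem eq_zero_of_mulVec_eq_zero_of_rank {κ : Type*} [Fintype κ] {n : ℕ}
    {M : Matrix κ (Fin n) ℝ} (hM : M.rank = n) {x : Fin n → ℝ} (hx : M *ᵥ x = 0) : x = 0 := by
  have h := LinearMap.finrank_range_add_finrank_ker M.mulVecLin
  have h' : Module.finrank ℝ (LinearMap.range M.mulVecLin) = n := hM
  rw [h', Module.finrank_fin_fun] at h
  have hk : Module.finrank ℝ (LinearMap.ker M.mulVecLin) = 0 := by omega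
  have hb := Submodule.finrank_eq_zero.1 hk
  have : x ∈ LinearMap.ker M.mulVecLin := hx
  rwa [hb, Submodule.mem_bot] at this

theorem IsObservable.eq_zero {n q : ℕ} {A : Matrix (Fin n) (Fin n) ℝ}
    {C : Matrix (Fin q) (Fin n) ℝ} (h : IsObservable A C) {x : Fin n → ℝ}
    (hx : ∀ k : ℕ, (C * A ^ k) *ᵥ x = 0) : x = 0 :=
  eq_zero_of_mulVec_eq_zero_of_rank h (funext fun p => congrFun (hx p.1) p.2)

theorem IsControllable.eq_zero {n m : ℕ} {A : Matrix (Fin n) (Fin n) ℝ}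
    {B : Matrix (Fin n) (Fin m) ℝ} (h : IsControllable A B) {x : Fin n → ℝ}
    (hx : ∀ k : ℕ, (Bᵀ * Aᵀ ^ k) *ᵥ x = 0) : x = 0 := by
  refine eq_zero_of_mulVec_eq_zero_of_rank (M := (controllabilityMatrix A B)ᵀ)
    ((Matrix.rank_transpose _).trans h) (funext fun p => ?_)
  have := congrFun (hx p.1) p.2
  rw [← Matrix.transpose_pow, ← Matrix.transpose_mul] at this
  exact this

theorem eq_zero_and_eq_zero_of_dotProduct_self {κ : Type*} [Fintype κ] {x y : κ → ℝ}
    (h : x ⬝ᵥ x + y ⬝ᵥ y ≤ 0) : x = 0 ∧ y = 0 := by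
  have hx : 0 ≤ x ⬝ᵥ x := Finset.sum_nonneg fun i _ => mul_self_nonneg _
  have hy : 0 ≤ y ⬝ᵥ y := Finset.sum_nonneg fun i _ => mul_self_nonneg _
  exact ⟨dotProduct_self_eq_zero.1 (by linarith), dotProduct_self_eq_zero.1 (by linarith)⟩

section

variable {n m q : ℕ} {A P : Matrix (Fin n) (Fin n) ℝ}

/-- The cross terms in `t` cancel by symmetry of `P`; what is left is `s` times the sum of the two
values of the form. -/
theorem quadratic_nonneg_of_re_nonneg {H : Matrix (Fin n) (Fin n) ℝ} (hP : P.PosDef)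
    {a b : Fin n → ℝ} {s t : ℝ} (hs : 0 ≤ s) (ha : H *ᵥ a = s • a + (-t) • b)
    (hb : H *ᵥ b = t • a + s • b) : 0 ≤ a ⬝ᵥ P *ᵥ (H *ᵥ a) + b ⬝ᵥ P *ᵥ (H *ᵥ b) := by
  have h1 := mul_nonneg hs (dotProduct_mulVec_nonneg hP.posSemidef a)
  have h2 := mul_nonneg hs (dotProduct_mulVec_nonneg hP.posSemidef b)
  simp only [ha, hb, Matrix.mulVec_add, Matrix.mulVec_smul, dotProduct_add, dotProduct_smul,
    smul_eq_mul, dotProduct_mulVec_comm hP.isHermitian b a]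
  linarith

/-- With this gain the `P`-form decreases by an extra `|C x|²`. An eigenvector with nonnegative real
part must then be annihilated by `C`, so it is an eigenvector of `A` as well, against observability.
-/
theorem isHurwitz_observer {C : Matrix (Fin q) (Fin n) ℝ} (hobs : IsObservable A C)
    (hP : IsLyapunovMatrix A P) : IsHurwitz (A - P⁻¹ * Cᵀ * C) := by
  intro μ hμ
  by_contra! hre
  obtain ⟨a, b, hab, ha, hb⟩ := exists_real_imag_eigenvector hμ
  have hq : ∀ x, x ⬝ᵥ P *ᵥ ((A - P⁻¹ * Cᵀ * C) *ᵥ x)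
      = x ⬝ᵥ P *ᵥ (A *ᵥ x) - (C *ᵥ x) ⬝ᵥ (C *ᵥ x) := fun x => by
    have hdet : IsUnit P.det := hP.1.det_pos.ne'.isUnit
    rw [Matrix.sub_mulVec, Matrix.mulVec_sub, dotProduct_sub, Matrix.mulVec_mulVec _ P (P⁻¹ * _ * _),
      Matrix.mul_assoc, Matrix.mul_nonsing_inv_cancel_left _ _ hdet, ← Matrix.mulVec_mulVec,
      Matrix.dotProduct_mulVec x Cᵀ, Matrix.vecMul_transpose]
  have h0 := quadratic_nonneg_of_re_nonneg hP.1 hre ha hb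
  rw [hq, hq] at h0
  obtain ⟨hCa, hCb⟩ := eq_zero_and_eq_zero_of_dotProduct_self
    (x := C *ᵥ a) (y := C *ᵥ b) (by linarith [hP.dotProduct_nonpos a, hP.dotProduct_nonpos b])
  have hA : ∀ x, C *ᵥ x = 0 → (A - P⁻¹ * Cᵀ * C) *ᵥ x = A *ᵥ x := fun x hx => by
    rw [Matrix.sub_mulVec, ← Matrix.mulVec_mulVec, hx, Matrix.mulVec_zero, sub_zero]
  rw [hA _ hCa] at ha
  rw [hA _ hCb] at hb
  have hk := mulVec_pow_eq_zero ha hb hCa hCb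
  exact hab ⟨hobs.eq_zero fun k => (hk k).1, hobs.eq_zero fun k => (hk k).2⟩

/-- As for the observer, an eigenvector `a + i b` with nonnegative real part is annihilated by `Bᵀ
P`. The remaining inequality forces the form of `P A + Aᵀ P` to vanish at `a` and `b`, which makes
the span of `P a`, `P b` invariant under `Aᵀ` and killed by `Bᵀ`, against controllability. -/
theorem isHurwitz_feedback {B : Matrix (Fin n) (Fin m) ℝ} (hctrl : IsControllable A B)
    (hP : IsLyapunovMatrix A P) {ρ : ℝ} (hρ : 0 < ρ) : IsHurwitz (A - ρ • (B * (Bᵀ * P))) := by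
  intro μ hμ
  by_contra! hre
  obtain ⟨a, b, hab, ha, hb⟩ := exists_real_imag_eigenvector hμ
  have hPt : Pᵀ = P := by
    have := hP.1.isHermitian.eq
    rwa [Matrix.conjTranspose_eq_transpose_of_trivial] at this
  have hq : ∀ x, x ⬝ᵥ P *ᵥ ((A - ρ • (B * (Bᵀ * P))) *ᵥ x)
      = x ⬝ᵥ P *ᵥ (A *ᵥ x) - ρ * (((Bᵀ * P) *ᵥ x) ⬝ᵥ ((Bᵀ * P) *ᵥ x)) := fun x => by
    rw [Matrix.sub_mulVec, Matrix.mulVec_sub, dotProduct_sub, Matrix.smul_mulVec,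
      Matrix.mulVec_smul, dotProduct_smul, smul_eq_mul, ← Matrix.mulVec_mulVec _ B,
      Matrix.mulVec_mulVec _ P B, Matrix.dotProduct_mulVec x (P * B), ← Matrix.mulVec_transpose,
      Matrix.transpose_mul, hPt]
  have h0 := quadratic_nonneg_of_re_nonneg hP.1 hre ha hb
  rw [hq, hq] at h0
  have hna := hP.dotProduct_nonpos a
  have hnb := hP.dotProduct_nonpos b
  have hsum : ((Bᵀ * P) *ᵥ a) ⬝ᵥ ((Bᵀ * P) *ᵥ a) + ((Bᵀ * P) *ᵥ b) ⬝ᵥ ((Bᵀ * P) *ᵥ b) ≤ 0 :=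
    nonpos_of_mul_nonpos_right (by linarith) hρ
  obtain ⟨hBa, hBb⟩ := eq_zero_and_eq_zero_of_dotProduct_self hsum
  have hA : ∀ x, (Bᵀ * P) *ᵥ x = 0 → (A - ρ • (B * (Bᵀ * P))) *ᵥ x = A *ᵥ x := fun x hx => by
    rw [Matrix.sub_mulVec, Matrix.smul_mulVec, ← Matrix.mulVec_mulVec, hx, Matrix.mulVec_zero,
      smul_zero, sub_zero]
  rw [hA _ hBa] at ha
  rw [hA _ hBb] at hb
  rw [hBa, hBb] at h0
  simp only [dotProduct_zero, mul_zero, sub_zero] at h0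
  -- A vector at which a semidefinite form vanishes lies in the kernel of its matrix.
  have hAt : ∀ x, x ⬝ᵥ P *ᵥ (A *ᵥ x) = 0 → Aᵀ *ᵥ (P *ᵥ x) = -(P *ᵥ (A *ᵥ x)) := fun x hx => by
    have h1 := (hP.2.dotProduct_mulVec_zero_iff x).1 (by
      rw [star_trivial, Matrix.neg_mulVec, dotProduct_neg, dotProduct_lyapunov hP.1.isHermitian, hx]
      simp)
    rw [Matrix.neg_mulVec, neg_eq_zero, Matrix.add_mulVec, ← Matrix.mulVec_mulVec,
      ← Matrix.mulVec_mulVec] at h1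
    exact eq_neg_of_add_eq_zero_right h1
  have ha' := hAt a (by linarith)
  have hb' := hAt b (by linarith)
  rw [ha, Matrix.mulVec_add, Matrix.mulVec_smul, Matrix.mulVec_smul, neg_add, ← neg_smul,
    ← neg_smul] at ha'
  rw [hb, Matrix.mulVec_add, Matrix.mulVec_smul, Matrix.mulVec_smul, neg_add, ← neg_smul,
    ← neg_smul] at hb'
  have hk := mulVec_pow_eq_zero (D := Bᵀ) ha' hb' (by rwa [Matrix.mulVec_mulVec])
    (by rwa [Matrix.mulVec_mulVec])
  have hinj : ∀ x, P *ᵥ x = 0 → x = 0 := fun x hx => by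
    by_contra hne
    have := dotProduct_mulVec_pos hP.1 hne
    simp [hx] at this
  exact hab ⟨hinj _ (hctrl.eq_zero fun k => (hk k).1), hinj _ (hctrl.eq_zero fun k => (hk k).2)⟩

end

/-! ### The network -/

/-- The Laplacian matrix with the links to the exosystem added on the diagonal. -/
def groundedLaplacian {N : ℕ} (G : WeightedGraph N) (𝒞 : Finset (Fin N)) :
    Matrix (Fin N) (Fin N) ℝ :=
  Matrix.diagonal (fun i => ∑ j, G.weight i j + leaderIndicator 𝒞 i) - G.weight

theorem leaderIndicator_nonneg {N : ℕ} (𝒞 : Finset (Fin N)) (i : Fin N) :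
    0 ≤ leaderIndicator 𝒞 i := by
  unfold leaderIndicator
  split <;> simp

/-- A maximum principle: if `β.re ≤ 0`, a component of maximal modulus passes its modulus to every
in-neighbour and cannot sit at a node of `𝒞`. Following a tree back to its root gives a
contradiction. -/
theorem re_eigenvalue_groundedLaplacian_pos {N : ℕ} {𝒞 : Finset (Fin N)} {G : WeightedGraph N}
    (hG : G ∈ rootedGraphs N 𝒞) {v : Fin N → ℂ} {β : ℂ} (hv : v ≠ 0)
    (h : ∀ i, ∑ j, (groundedLaplacian G 𝒞 i j : ℂ) * v j = β * v i) : 0 < β.re := by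
  by_contra! hβ
  obtain ⟨i₀, hi₀⟩ := Function.ne_iff.1 hv
  obtain ⟨i, -, hmax⟩ := Finset.exists_max_image Finset.univ (fun j => ‖v j‖) ⟨i₀, Finset.mem_univ _⟩
  have hpos : 0 < ‖v i‖ := (norm_pos_iff.2 hi₀).trans_le (hmax _ (Finset.mem_univ _))
  have hstep : ∀ k, ‖v k‖ = ‖v i‖ → k ∉ 𝒞 ∧ ∀ j, G.Edge j k → ‖v j‖ = ‖v i‖ := by
    intro k hk
    have h1 : ((∑ j, G.weight k j + leaderIndicator 𝒞 k : ℝ) - β) * v k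
        = ∑ j, (G.weight k j : ℂ) * v j := by
      have := h k
      simp only [groundedLaplacian, Matrix.sub_apply, Matrix.diagonal_apply, Complex.ofReal_sub,
        sub_mul, Finset.sum_sub_distrib] at this
      rw [Finset.sum_eq_single k (by intro j _ hj; simp [hj.symm]) (by simp), if_pos rfl] at this
      rw [sub_mul, ← this]
      ring
    have h2 : (∑ j, G.weight k j + leaderIndicator 𝒞 k) * ‖v i‖ ≤ ∑ j, G.weight k j * ‖v j‖ := by
      calc (∑ j, G.weight k j + leaderIndicator 𝒞 k) * ‖v i‖
          ≤ ‖((∑ j, G.weight k j + leaderIndicator 𝒞 k : ℝ) - β)‖ * ‖v k‖ := by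
            rw [hk]
            gcongr
            refine le_trans ?_ (Complex.re_le_norm _)
            simp only [Complex.sub_re, Complex.ofReal_re]
            linarith
        _ = ‖∑ j, (G.weight k j : ℂ) * v j‖ := by rw [← norm_mul, h1]
        _ ≤ ∑ j, ‖(G.weight k j : ℂ) * v j‖ := norm_sum_le _ _
        _ = ∑ j, G.weight k j * ‖v j‖ := Finset.sum_congr rfl fun j _ => by
            rw [norm_mul, Complex.norm_real, Real.norm_of_nonneg (G.weight_nonneg k j)]
    -- All terms on the left are nonnegative by maximality of `‖v i‖`, so each of them vanishes.
    have h3 : leaderIndicator 𝒞 k * ‖v i‖ + ∑ j, G.weight k j * (‖v i‖ - ‖v j‖) ≤ 0 := by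
      simp only [mul_sub, Finset.sum_sub_distrib, ← Finset.sum_mul]
      linarith
    have h4 : ∀ j ∈ Finset.univ, 0 ≤ G.weight k j * (‖v i‖ - ‖v j‖) := fun j hj =>
      mul_nonneg (G.weight_nonneg k j) (sub_nonneg.2 (hmax j hj))
    have h5 := Finset.sum_nonneg h4
    have h6 := mul_nonneg (leaderIndicator_nonneg 𝒞 k) hpos.le
    refine ⟨fun hmem => ?_, fun j hj => ?_⟩
    · rw [leaderIndicator, if_pos hmem, one_mul] at h3
      linarith
    · have h7 := (Finset.sum_eq_zero_iff_of_nonneg h4).1 (by linarith) j (Finset.mem_univ j)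
      have h8 := (mul_eq_zero.1 h7).resolve_left (ne_of_gt hj)
      linarith
  obtain ⟨V, E, r, hr, hi, htree⟩ := hG i
  have hroot : ∀ k, Relation.ReflTransGen E k i → ‖v k‖ = ‖v i‖ := fun k hk => by
    induction hk using Relation.ReflTransGen.head_induction_on with
    | refl => rfl
    | head hab _ ih => exact (hstep _ ih).2 _ (htree.edge_sub _ _ hab).2.2
  exact (hstep r (hroot r (htree.reachable i hi))).1 hr

/-- The matrix `I ⊗ A - L ⊗ I`. -/
def networkMatrix {N n : ℕ} (L : Matrix (Fin N) (Fin N) ℝ) (A : Matrix (Fin n) (Fin n) ℝ) :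
    Matrix (Fin N × Fin n) (Fin N × Fin n) ℝ :=
  Matrix.of fun p r => (if p.1 = r.1 then A p.2 r.2 else 0) - if p.2 = r.2 then L p.1 r.1 else 0

theorem sum_network {N n : ℕ} {R : Type*} [CommRing R] (i : Fin N) (a : Fin n) (f : Fin n → R)
    (g : Fin N → R) (z : Fin N × Fin n → R) :
    ∑ p : Fin N × Fin n, ((if i = p.1 then f p.2 else 0) - if a = p.2 then g p.1 else 0) * z p
      = ∑ b, f b * z (i, b) - ∑ j, g j * z (j, a) := by
  simp only [sub_mul, Finset.sum_sub_distrib, ite_mul, zero_mul]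
  congr 1
  · rw [Fintype.sum_prod_type_right]
    simp
  · rw [Fintype.sum_prod_type]
    simp

theorem networkMatrix_mulVec {N n : ℕ} (L : Matrix (Fin N) (Fin N) ℝ)
    (A : Matrix (Fin n) (Fin n) ℝ) (z : Fin N × Fin n → ℝ) (i : Fin N) (a : Fin n) :
    (networkMatrix L A *ᵥ z) (i, a) = ∑ b, A a b * z (i, b) - ∑ j, L i j * z (j, a) :=
  sum_network i a (A a) (L i) z

/-- `I ⊗ A` commutes with the network matrix, so it has an eigenvector `w`, with eigenvalue `ν`,
inside the `μ`-eigenspace. One slice of `w` is an eigenvector of `A` for `ν`, another an eigenvector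
of `L` for `ν - μ`. -/
theorem re_eigenvalue_networkMatrix_neg {N n : ℕ} {L : Matrix (Fin N) (Fin N) ℝ}
    {A : Matrix (Fin n) (Fin n) ℝ}
    (hA : ∀ μ : ℂ, (complexify A).HasEigenvalue μ → μ.re ≤ 0)
    (hL : ∀ (v : Fin N → ℂ) (β : ℂ), v ≠ 0 →
      (∀ i, ∑ j, (L i j : ℂ) * v j = β * v i) → 0 < β.re) {μ : ℂ}
    (hμ : Module.End.HasEigenvalue
      (Matrix.toLin' ((networkMatrix L A).map (algebraMap ℝ ℂ))) μ) : μ.re < 0 := by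
  set T : Module.End ℂ (Fin N × Fin n → ℂ) := Matrix.toLin' ((networkMatrix L A).map (algebraMap ℝ ℂ)) with hT
  let S₁ : Module.End ℂ (Fin N × Fin n → ℂ) :=
    { toFun := fun v p => ∑ b, (A p.2 b : ℂ) * v (p.1, b)
      map_add' := fun v w => by ext p; simp [mul_add, Finset.sum_add_distrib]
      map_smul' := fun c v => by
        ext p
        simp only [Pi.smul_apply, smul_eq_mul, RingHom.id_apply, Finset.mul_sum]
        exact Finset.sum_congr rfl fun b _ => by ring }
  have hTa : ∀ v i a, T v (i, a) = S₁ v (i, a) - ∑ j, (L i j : ℂ) * v (j, a) := fun v i a => by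
    refine Eq.trans (Finset.sum_congr rfl fun p _ => ?_)
      (sum_network i a (fun b => (A a b : ℂ)) (fun j => (L i j : ℂ)) v)
    simp only [networkMatrix, Matrix.map_apply, Matrix.of_apply, Complex.coe_algebraMap]
    split_ifs <;> simp
  have hcomm : ∀ v, T (S₁ v) = S₁ (T v) := fun v => by
    ext ⟨i, a⟩
    rw [hTa]
    change _ = ∑ b, (A a b : ℂ) * T v (i, b)
    simp only [hTa, mul_sub, Finset.sum_sub_distrib]
    congr 1
    change ∑ j, (L i j : ℂ) * ∑ b, (A a b : ℂ) * v (j, b) = _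
    simp only [Finset.mul_sum]
    rw [Finset.sum_comm]
    exact Finset.sum_congr rfl fun b _ => Finset.sum_congr rfl fun j _ => by ring
  have hinv : ∀ v ∈ T.eigenspace μ, S₁ v ∈ T.eigenspace μ := fun v hv => by
    rw [Module.End.mem_eigenspace_iff] at hv ⊢
    rw [hcomm, hv, map_smul]
  have : Nontrivial (T.eigenspace μ) := (Submodule.nontrivial_iff_ne_bot).2 hμ
  obtain ⟨ν, hν⟩ := Module.End.exists_eigenvalue (S₁.restrict hinv)
  obtain ⟨w, hw⟩ := hν.exists_hasEigenvector
  have hw₁ : S₁ w = ν • (w : Fin N × Fin n → ℂ) := congrArg Subtype.val hw.apply_eq_smul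
  have hw₂ : T w = μ • (w : Fin N × Fin n → ℂ) := Module.End.mem_eigenspace_iff.1 w.2
  have hw0 : (w : Fin N × Fin n → ℂ) ≠ 0 := fun h => hw.2 (Subtype.ext h)
  obtain ⟨⟨i₀, a₀⟩, h0⟩ := Function.ne_iff.1 hw0
  have hνre : ν.re ≤ 0 := by
    refine hA ν (Module.End.hasEigenvalue_of_hasEigenvector
      (x := fun a => (w : Fin N × Fin n → ℂ) (i₀, a)) ⟨?_, fun h => h0 (congrFun h a₀)⟩)
    rw [Module.End.mem_eigenspace_iff]
    ext a
    have := congrFun hw₁ (i₀, a)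
    simpa [complexify, Matrix.mulVec, dotProduct, S₁] using this
  have hβ := hL (fun i => (w : Fin N × Fin n → ℂ) (i, a₀)) (ν - μ)
    (fun h => h0 (congrFun h i₀)) fun i => by
      have h1 := hTa w i a₀
      rw [hw₁, hw₂] at h1
      simp only [Pi.smul_apply, smul_eq_mul] at h1
      rw [sub_mul, h1]
      ring
  rw [Complex.sub_re] at hβ
  linarith

/-! ### Saturation -/

theorem sat_eq_max_min (s : ℝ) : sat s = max (-1) (min 1 s) := by
  unfold sat
  rcases lt_trichotomy s 0 with h | h | h
  · rw [Real.sign_of_neg h, abs_of_neg h, min_eq_right (by linarith : s ≤ 1)]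
    rcases le_total 1 (-s) with h1 | h1
    · rw [min_eq_left h1, max_eq_left (by linarith)]; ring
    · rw [min_eq_right h1, max_eq_right (by linarith)]; ring
  · simp [h]
  · rw [Real.sign_of_pos h, abs_of_pos h, one_mul, max_eq_right]
    exact le_min (by norm_num) (by linarith)

theorem sat_neg (s : ℝ) : sat (-s) = -sat s := by
  simp [sat, Real.sign_neg]

theorem mul_sat_nonneg (s : ℝ) : 0 ≤ s * sat s := by
  unfold sat
  rw [← mul_assoc]
  have : s * Real.sign s = |s| := by
    rcases lt_trichotomy s 0 with h | h | h
    · rw [Real.sign_of_neg h, abs_of_neg h]; ring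
    · simp [h]
    · rw [Real.sign_of_pos h, abs_of_pos h]; ring
  rw [this]
  positivity

/-- The defect is zero for `|s| ≤ 1` and `|s| - 1` beyond, where `s * sat s = |s|`. Through this
estimate the dissipation controls the saturation error. -/
theorem abs_sub_sat_le (s : ℝ) : |s - sat s| ≤ s * sat s := by
  rcases le_total s (-1) with h | h
  · have : sat s = -1 := by rw [sat_eq_max_min, min_eq_right (by linarith), max_eq_left h]
    rw [this, abs_le]; constructor <;> linarith
  rcases le_total s 1 with h' | h'
  · have : sat s = s := by rw [sat_eq_max_min, min_eq_right h', max_eq_right h]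
    rw [this, sub_self, abs_zero]; exact mul_self_nonneg s
  · have : sat s = 1 := by rw [sat_eq_max_min, min_eq_left h', max_eq_right (by norm_num)]
    rw [this, abs_le]; constructor <;> linarith

theorem lipschitzWith_satVec {m : ℕ} : LipschitzWith 1 (satVec : (Fin m → ℝ) → Fin m → ℝ) := by
  have : (satVec : (Fin m → ℝ) → Fin m → ℝ) = clamp 1 := by
    funext v k
    simp [satVec, clamp, sat_eq_max_min]
  rw [this]
  exact lipschitzWith_clamp 1

/-! ### Stabilization of a single saturated agent -/

section Agent

variable {n m : ℕ} {A P : Matrix (Fin n) (Fin n) ℝ} {B : Matrix (Fin n) (Fin m) ℝ} {ρ : ℝ}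

/-- The dissipation `∑ s_k sat(s_k)` at the input `-s = -ρ Bᵀ P x`. -/
noncomputable def dissipation (B : Matrix (Fin n) (Fin m) ℝ) (P : Matrix (Fin n) (Fin n) ℝ) (ρ : ℝ)
    (x : Fin n → ℝ) : ℝ :=
  ∑ k, (ρ * ((Bᵀ * P) *ᵥ x) k) * sat (ρ * ((Bᵀ * P) *ᵥ x) k)

theorem dissipation_nonneg (x : Fin n → ℝ) : 0 ≤ dissipation B P ρ x :=
  Finset.sum_nonneg fun _ _ => mul_sat_nonneg _

theorem satVec_feedback_apply (x : Fin n → ℝ) (k : Fin m) :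
    satVec (feedback B P ρ x) k = -sat (ρ * ((Bᵀ * P) *ᵥ x) k) := by
  simp [satVec, feedback, sat_neg]

theorem mul_dotProduct_satVec_feedback (hP : P.PosDef) (x : Fin n → ℝ) :
    ρ * (x ⬝ᵥ P *ᵥ (B *ᵥ satVec (feedback B P ρ x))) = -dissipation B P ρ x := by
  have hPt : Pᵀ = P := by
    have := hP.isHermitian.eq
    rwa [Matrix.conjTranspose_eq_transpose_of_trivial] at this
  have h : x ⬝ᵥ P *ᵥ (B *ᵥ satVec (feedback B P ρ x))
      = ((Bᵀ * P) *ᵥ x) ⬝ᵥ satVec (feedback B P ρ x) := by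
    rw [Matrix.mulVec_mulVec, Matrix.dotProduct_mulVec, ← Matrix.mulVec_transpose,
      Matrix.transpose_mul, hPt]
  rw [h, dissipation, dotProduct, Finset.mul_sum, ← Finset.sum_neg_distrib]
  refine Finset.sum_congr rfl fun k _ => ?_
  rw [satVec_feedback_apply]
  ring

theorem norm_saturation_defect_le (x : Fin n → ℝ) :
    ‖ρ • ((Bᵀ * P) *ᵥ x) + satVec (feedback B P ρ x)‖ ≤ dissipation B P ρ x := by
  rw [pi_norm_le_iff_of_nonneg (dissipation_nonneg x)]
  intro k
  rw [Pi.add_apply, satVec_feedback_apply, Pi.smul_apply, smul_eq_mul, ← sub_eq_add_neg,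
    Real.norm_eq_abs]
  exact (abs_sub_sat_le _).trans (Finset.single_le_sum
    (f := fun k => (ρ * ((Bᵀ * P) *ᵥ x) k) * sat (ρ * ((Bᵀ * P) *ᵥ x) k))
    (fun _ _ => mul_sat_nonneg _) (Finset.mem_univ k))

variable {χ f : ℝ → Fin n → ℝ}

/-- Neither the drift nor the saturated feedback increases the `P`-form, so only `f` can. Its
contribution is linear in `‖χ‖`, and `f` decays exponentially. -/
theorem exists_norm_le_of_saturated (hP : IsLyapunovMatrix A P) (hρ : 0 < ρ)
    (hχ : HasDynamics χ fun t => A *ᵥ χ t + B *ᵥ satVec (feedback B P ρ (χ t)) + f t)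
    (hf : ExpDecay f) : ∃ R, 0 ≤ R ∧ ∀ t, 0 ≤ t → ‖χ t‖ ≤ R := by
  obtain ⟨M, hM, hMb⟩ := exists_abs_dotProduct_mulVec_le P
  obtain ⟨ε, hε, hεb⟩ := exists_coercive hP.1
  have hVb : ∃ b, ∀ t, 0 ≤ t → χ t ⬝ᵥ P *ᵥ χ t ≤ b := by
    refine exists_bound_of_deriv_le (fun t _ => dotProduct_mulVec_nonneg hP.1.posSemidef _)
      (fun t ht => hasDerivWithinAt_quadratic hP.1.isHermitian (hχ t ht))
      (h := fun t => M * (1 + ε⁻¹) * ‖f t‖) (fun t _ => ?_)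
      (hf.of_norm_le (M := M * (1 + ε⁻¹)) (by positivity) fun t _ => ?_)
    · simp only [Matrix.mulVec_add, dotProduct_add]
      have h1 := hP.dotProduct_nonpos (χ t)
      have h2 : χ t ⬝ᵥ P *ᵥ (B *ᵥ satVec (feedback B P ρ (χ t))) ≤ 0 := by
        have := mul_dotProduct_satVec_feedback (B := B) (ρ := ρ) hP.1 (χ t)
        have h0 := dissipation_nonneg (B := B) (P := P) (ρ := ρ) (χ t)
        exact nonpos_of_mul_nonpos_right (by linarith) hρ
      have h3 := (le_abs_self _).trans (hMb (χ t) (f t))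
      -- From `2‖χ‖ ≤ 1 + ‖χ‖²`, to reach the shape `h * (1 + V)`.
      have h4 : 2 * ‖χ t‖ ≤ (1 + ε⁻¹) * (1 + χ t ⬝ᵥ P *ᵥ χ t) := by
        have h5 : ‖χ t‖ ^ 2 ≤ ε⁻¹ * (χ t ⬝ᵥ P *ᵥ χ t) := by
          rw [inv_mul_eq_div, le_div_iff₀ hε]; linarith [hεb (χ t)]
        have h6 := dotProduct_mulVec_nonneg hP.1.posSemidef (χ t)
        have h7 : 0 < ε⁻¹ := inv_pos.2 hε
        nlinarith [sq_nonneg (‖χ t‖ - 1)]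
      have h8 := mul_le_mul_of_nonneg_left h4 (mul_nonneg hM (norm_nonneg (f t)))
      linarith
    · rw [norm_mul, norm_norm, Real.norm_of_nonneg (by positivity)]
  obtain ⟨b, hb⟩ := hVb
  have hb0 : 0 ≤ b := (dotProduct_mulVec_nonneg hP.1.posSemidef _).trans (hb 0 le_rfl)
  refine ⟨1 + b / ε, by positivity, fun t ht => ?_⟩
  have h1 : ‖χ t‖ ^ 2 ≤ b / ε := by
    rw [le_div_iff₀ hε]; linarith [hεb (χ t), hb t ht]
  nlinarith [sq_nonneg (‖χ t‖ - 1)]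

/-- The Lyapunov function is the `Q`-form, strict for the unsaturated loop, plus `k` times the
`P`-form. The bound `R` on `χ` makes the saturation error in the first linear in the dissipation,
which the second supplies with a negative sign. -/
theorem ExpDecay.of_saturated (hctrl : IsControllable A B) (hP : IsLyapunovMatrix A P)
    (hρ : 0 < ρ)
    (hχ : HasDynamics χ fun t => A *ᵥ χ t + B *ᵥ satVec (feedback B P ρ (χ t)) + f t)
    (hf : ExpDecay f) : ExpDecay χ := by
  obtain ⟨R, hR, hRb⟩ := exists_norm_le_of_saturated hP hρ hχ hf
  obtain ⟨M, hM, hMb⟩ := exists_abs_dotProduct_mulVec_le P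
  obtain ⟨Q, c, hQ, hc, hQc⟩ := exists_strict_lyapunov_matrix _ (isHurwitz_feedback hctrl hP hρ)
  obtain ⟨L, hL, hLb⟩ := exists_abs_dotProduct_mulVec_le Q
  obtain ⟨ε, hε, hεb⟩ := exists_coercive hQ
  obtain ⟨β, hβ, hβb⟩ := exists_norm_mulVec_le B
  -- The exact weight for which the two dissipation terms cancel; the factor `ρ` offsets the `ρ`
  -- built into the dissipation.
  set k := L * R * β * ρ with hk
  have hk0 : 0 ≤ k := by positivity
  have hVW : ∀ x, x ⬝ᵥ P *ᵥ x ≤ M / ε * (x ⬝ᵥ Q *ᵥ x) := fun x => by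
    calc x ⬝ᵥ P *ᵥ x ≤ M * (‖x‖ * ‖x‖) := (le_abs_self _).trans (hMb x x)
      _ = M / ε * (ε * ‖x‖ ^ 2) := by field_simp
      _ ≤ _ := by gcongr; exact hεb x
  have hU : ExpDecay fun t => χ t ⬝ᵥ Q *ᵥ χ t + k * (χ t ⬝ᵥ P *ᵥ χ t) := by
    refine ExpDecay.of_deriv_le (c := 2 * c / (1 + k * (M / ε)))
      (h := fun t => (2 * L * R + 2 * k * M * R) * ‖f t‖) (by positivity) (fun t _ => ?_)
      (fun t ht => (hasDerivWithinAt_quadratic hQ.isHermitian (hχ t ht)).add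
        ((hasDerivWithinAt_quadratic hP.1.isHermitian (hχ t ht)).const_mul k))
      (fun t ht => ?_) (hf.of_norm_le (M := 2 * L * R + 2 * k * M * R) (by positivity)
        fun t _ => ?_)
    · exact add_nonneg (dotProduct_mulVec_nonneg hQ.posSemidef _)
        (mul_nonneg hk0 (dotProduct_mulVec_nonneg hP.1.posSemidef _))
    · set x := χ t with hx
      set g := dissipation B P ρ x with hg
      set η := ρ • ((Bᵀ * P) *ᵥ x) + satVec (feedback B P ρ x) with hη
      have hsplit : A *ᵥ x + B *ᵥ satVec (feedback B P ρ x) + f t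
          = (A - ρ • (B * (Bᵀ * P))) *ᵥ x + B *ᵥ η + f t := by
        rw [hη, Matrix.sub_mulVec, Matrix.smul_mulVec, Matrix.mulVec_add, Matrix.mulVec_smul,
          Matrix.mulVec_mulVec]
        abel
      have hW : x ⬝ᵥ Q *ᵥ (A *ᵥ x + B *ᵥ satVec (feedback B P ρ x) + f t)
          ≤ -c * (x ⬝ᵥ Q *ᵥ x) + L * R * β * g + L * R * ‖f t‖ := by
        rw [hsplit, Matrix.mulVec_add, Matrix.mulVec_add, dotProduct_add, dotProduct_add]
        have h1 : x ⬝ᵥ Q *ᵥ (B *ᵥ η) ≤ L * R * β * g := by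
          refine (le_abs_self _).trans ((hLb _ _).trans ?_)
          calc L * (‖x‖ * ‖B *ᵥ η‖) ≤ L * (R * (β * g)) := by
                gcongr
                · exact hRb t ht
                · exact (hβb η).trans (by gcongr; exact norm_saturation_defect_le x)
            _ = _ := by ring
        have h2 : x ⬝ᵥ Q *ᵥ f t ≤ L * R * ‖f t‖ := by
          refine (le_abs_self _).trans ((hLb _ _).trans ?_)
          rw [mul_assoc]
          gcongr
          exact hRb t ht
        linarith [hQc x]
      have hV : k * (x ⬝ᵥ P *ᵥ (A *ᵥ x + B *ᵥ satVec (feedback B P ρ x) + f t))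
          ≤ -(L * R * β * g) + k * M * R * ‖f t‖ := by
        rw [Matrix.mulVec_add, Matrix.mulVec_add, dotProduct_add, dotProduct_add]
        have h1 := mul_nonpos_of_nonneg_of_nonpos hk0 (hP.dotProduct_nonpos x)
        have h2 : k * (x ⬝ᵥ P *ᵥ (B *ᵥ satVec (feedback B P ρ x))) = -(L * R * β * g) := by
          rw [hk, mul_assoc _ ρ, mul_dotProduct_satVec_feedback hP.1]
          ring
        have h3 : k * (x ⬝ᵥ P *ᵥ f t) ≤ k * M * R * ‖f t‖ := by
          have h4 : x ⬝ᵥ P *ᵥ f t ≤ M * (R * ‖f t‖) := by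
            refine (le_abs_self _).trans ((hMb _ _).trans ?_)
            gcongr
            exact hRb t ht
          calc _ ≤ k * (M * (R * ‖f t‖)) := mul_le_mul_of_nonneg_left h4 hk0
            _ = _ := by ring
        linarith
      have hcomp : 2 * c / (1 + k * (M / ε)) * (x ⬝ᵥ Q *ᵥ x + k * (x ⬝ᵥ P *ᵥ x))
          ≤ 2 * c * (x ⬝ᵥ Q *ᵥ x) := by
        have h1 := mul_le_mul_of_nonneg_left (hVW x) hk0
        rw [div_mul_eq_mul_div, div_le_iff₀ (by positivity), mul_assoc (2 * c)]
        gcongr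
        linarith
      linarith
    · rw [norm_mul, norm_norm, Real.norm_of_nonneg (by positivity)]
  refine ExpDecay.of_norm_pow_two (hU.of_norm_le (M := ε⁻¹) (by positivity) fun t _ => ?_)
  have h1 := mul_nonneg hk0 (dotProduct_mulVec_nonneg hP.1.posSemidef (χ t))
  have h2 := dotProduct_mulVec_nonneg hQ.posSemidef (χ t)
  rw [norm_pow, norm_norm, Real.norm_of_nonneg (by linarith), inv_mul_eq_div, le_div_iff₀ hε]
  linarith [hεb (χ t)]

end Agent

/-! ### Closed-loop convergence -/

theorem ExpDecay.pi {κ E : Type*} [Fintype κ] [SeminormedAddCommGroup E] {f : ℝ → κ → E}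
    (hf : ∀ k, ExpDecay fun t => f t k) : ExpDecay f := by
  have hsum : ∀ s : Finset κ, ExpDecay fun t => ∑ k ∈ s, ‖f t k‖ := by
    intro s
    induction s using Finset.cons_induction with
    | empty => exact ⟨0, 1, le_rfl, one_pos, by simp⟩
    | cons a s ha ih =>
      simp only [Finset.sum_cons]
      exact ((hf a).of_norm_le zero_le_one fun t _ => by simp).add ih
  refine (hsum Finset.univ).of_norm_le zero_le_one fun t _ => ?_
  have h0 : 0 ≤ ∑ k, ‖f t k‖ := by positivity
  rw [one_mul, Real.norm_of_nonneg h0, pi_norm_le_iff_of_nonneg h0]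
  exact fun k => Finset.single_le_sum (f := fun k => ‖f t k‖) (fun _ _ => norm_nonneg _)
    (Finset.mem_univ k)

theorem ExpDecay.sum_smul {κ E : Type*} [SeminormedAddCommGroup E] [NormedSpace ℝ E]
    (s : Finset κ) (w : κ → ℝ) {f : κ → ℝ → E} (hf : ∀ k, ExpDecay (f k)) :
    ExpDecay fun t => ∑ k ∈ s, w k • f k t := by
  induction s using Finset.cons_induction with
  | empty => exact ⟨0, 1, le_rfl, one_pos, by simp⟩
  | cons a s ha ih =>
    simp only [Finset.sum_cons]
    exact ((hf a).of_norm_le (abs_nonneg (w a)) fun t _ => (norm_smul _ _).le).add ih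

section Network

variable {N : ℕ} (G : WeightedGraph N) (𝒞 : Finset (Fin N))

theorem exchange_add_smul_eq {κ : Type} (ξ : Fin N → κ → ℝ) (i : Fin N) :
    exchange G ξ i + leaderIndicator 𝒞 i • ξ i = ∑ j, groundedLaplacian G 𝒞 i j • ξ j := by
  have h : ∑ j, Matrix.diagonal (fun i => ∑ j, G.weight i j + leaderIndicator 𝒞 i) i j • ξ j
      = (∑ j, G.weight i j + leaderIndicator 𝒞 i) • ξ i := by
    rw [Finset.sum_eq_single i (fun j _ hj => by simp [Matrix.diagonal_apply_ne' _ hj]) (by simp),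
      Matrix.diagonal_apply_eq]
  simp only [groundedLaplacian, Matrix.sub_apply, sub_smul, Finset.sum_sub_distrib, h, exchange,
    smul_sub, add_smul, Finset.sum_smul]
  abel

theorem measurement_eq {n q : ℕ} (C : Matrix (Fin q) (Fin n) ℝ) (x : Fin N → Fin n → ℝ)
    (xr : Fin n → ℝ) (i : Fin N) :
    measurement G 𝒞 (fun j => C *ᵥ x j) (C *ᵥ xr) i
      = C *ᵥ ∑ j, groundedLaplacian G 𝒞 i j • (x j - xr) := by
  rw [← exchange_add_smul_eq G 𝒞 (fun j => x j - xr), Matrix.mulVec_add, Matrix.mulVec_smul,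
    Matrix.mulVec_sub, measurement, exchange, exchange, Matrix.mulVec_sum]
  congr 1
  refine Finset.sum_congr rfl fun j _ => ?_
  rw [Matrix.mulVec_smul, sub_sub_sub_cancel_right, Matrix.mulVec_sub]

end Network

section ClosedLoop

variable {n m q N : ℕ} {A P : Matrix (Fin n) (Fin n) ℝ} {B : Matrix (Fin n) (Fin m) ℝ}
  {C : Matrix (Fin q) (Fin n) ℝ} {F : Matrix (Fin n) (Fin q) ℝ} {ρ : ℝ}
  {G : WeightedGraph N} {𝒞 : Finset (Fin N)}
  {x : Fin N → ℝ → Fin n → ℝ} {xr : ℝ → Fin n → ℝ} {xh χ : Fin N → ℝ → Fin n → ℝ}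

theorem IsObserverSolution.hasDynamics_error (h : IsObserverSolution A B C P F ρ G 𝒞 x xr xh χ)
    (i : Fin N) : HasDynamics (fun t => x i t - xr t) fun t =>
      A *ᵥ (x i t - xr t) + B *ᵥ satVec (feedback B P ρ (χ i t)) := fun t ht => by
  refine ((h.agents i t ht).fun_sub (h.exosystem t ht)).congr_deriv ?_
  beta_reduce
  rw [Matrix.mulVec_sub]
  abel

/-- The observer receives precisely the combination of saturated inputs that drives `∑_j L_ij e_j`,
so the estimation error is an unforced linear system. -/
theorem IsObserverSolution.expDecay_observer_error
    (h : IsObserverSolution A B C P F ρ G 𝒞 x xr xh χ) (hF : IsHurwitz (A - F * C)) (i : Fin N) :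
    ExpDecay fun t => ∑ j, groundedLaplacian G 𝒞 i j • (x j t - xr t) - xh i t := by
  obtain ⟨Q, c, hQ, hc, hQc⟩ := exists_strict_lyapunov_matrix _ hF
  refine ExpDecay.of_lyapunov hQ hc hQc (f := fun _ => 0) (fun t ht => ?_)
    ⟨0, 1, le_rfl, one_pos, by simp⟩
  have h1 : HasDerivWithinAt (fun t => ∑ j, groundedLaplacian G 𝒞 i j • (x j t - xr t)) _
      (Set.Ici 0) t :=
    HasDerivWithinAt.fun_sum fun j (_ : j ∈ Finset.univ) =>
      (h.hasDynamics_error j t ht).const_smul (groundedLaplacian G 𝒞 i j)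
  refine (h1.fun_sub (h.observer i t ht)).congr_deriv ?_
  beta_reduce
  rw [measurement_eq]
  have h2 : B *ᵥ exchange G (fun j => satVec (feedback B P ρ (χ j t))) i
      + leaderIndicator 𝒞 i • (B *ᵥ satVec (feedback B P ρ (χ i t)))
      = ∑ j, groundedLaplacian G 𝒞 i j • (B *ᵥ satVec (feedback B P ρ (χ j t))) := by
    rw [← Matrix.mulVec_smul, ← Matrix.mulVec_add,
      exchange_add_smul_eq G 𝒞 (fun j => satVec (feedback B P ρ (χ j t))), Matrix.mulVec_sum]
    simp only [Matrix.mulVec_smul]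
  have h3 : ∑ j, groundedLaplacian G 𝒞 i j • (A *ᵥ (x j t - xr t))
      = A *ᵥ ∑ j, groundedLaplacian G 𝒞 i j • (x j t - xr t) := by
    rw [Matrix.mulVec_sum]
    simp only [Matrix.mulVec_smul]
  simp only [smul_add, Finset.sum_add_distrib, h3, ← h2]
  rw [add_zero, Matrix.sub_mulVec, Matrix.mulVec_sub A, Matrix.mulVec_sub (F * C),
    Matrix.mulVec_sub F, Matrix.mulVec_mulVec, Matrix.mulVec_mulVec]
  abel

/-- The saturated input enters `x_i` and `χ_i` alike and drops out of the difference. The network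
matrix then governs the stacked differences, with the observer error as forcing. -/
theorem IsObserverSolution.expDecay_tracking_error
    (h : IsObserverSolution A B C P F ρ G 𝒞 x xr xh χ) (hA : IsNeutrallyStable A)
    (hF : IsHurwitz (A - F * C)) (hG : G ∈ rootedGraphs N 𝒞) (i : Fin N) :
    ExpDecay fun t => x i t - xr t - χ i t := by
  obtain ⟨Q, c, hQ, hc, hQc⟩ := exists_strict_lyapunov_matrix
    (networkMatrix (groundedLaplacian G 𝒞) A) fun μ hμ => re_eigenvalue_networkMatrix_neg
      (fun μ hμ => (hA μ hμ).1) (fun v β hv hβ => re_eigenvalue_groundedLaplacian_pos hG hv hβ) hμ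
  have hnet : ExpDecay fun t => fun p : Fin N × Fin n => (x p.1 t - xr t - χ p.1 t) p.2 := by
    refine ExpDecay.of_lyapunov hQ hc hQc (f := fun t p =>
      (∑ j, groundedLaplacian G 𝒞 p.1 j • (x j t - xr t) - xh p.1 t) p.2) (fun t ht => ?_)
      (ExpDecay.pi fun p => (h.expDecay_observer_error hF p.1).of_norm_le zero_le_one fun t _ => by
        rw [one_mul]; exact norm_le_pi_norm _ p.2)
    rw [hasDerivWithinAt_pi]
    rintro ⟨i, a⟩
    have h1 := hasDerivWithinAt_pi.1
      ((h.hasDynamics_error i t ht).fun_sub (h.controller i t ht)) a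
    refine h1.congr_deriv ?_
    beta_reduce
    have h2 := congrFun (exchange_add_smul_eq G 𝒞 (fun j => χ j t) i) a
    have h3 : ∑ b, A a b * (x i t - xr t - χ i t) b
        = (A *ᵥ (x i t - xr t)) a - (A *ᵥ χ i t) a := by
      rw [← Pi.sub_apply (A *ᵥ _), ← Matrix.mulVec_sub]
      rfl
    have h4 : ∑ j, groundedLaplacian G 𝒞 i j * (x j t - xr t - χ j t) a
        = (∑ j, groundedLaplacian G 𝒞 i j • (x j t - xr t)) a
          - (∑ j, groundedLaplacian G 𝒞 i j • χ j t) a := by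
      simp only [Finset.sum_apply, Pi.smul_apply, smul_eq_mul]
      rw [← Finset.sum_sub_distrib]
      exact Finset.sum_congr rfl fun j _ => by rw [Pi.sub_apply _ (χ j t)]; ring
    rw [Pi.add_apply, networkMatrix_mulVec, h3, h4, ← h2]
    simp only [Pi.sub_apply, Pi.add_apply]
    ring
  refine ExpDecay.pi fun a => hnet.of_norm_le zero_le_one fun t _ => ?_
  rw [one_mul]
  exact norm_le_pi_norm (fun p : Fin N × Fin n => (x p.1 t - xr t - χ p.1 t) p.2) (i, a)

/-- The term `x̂_i - ∑_j L_ij χ_j` equals `∑_j L_ij (e_j - χ_j)` minus the observer error. It is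
thus an exponentially decaying input, and the agents decouple. -/
theorem IsObserverSolution.expDecay_controller
    (h : IsObserverSolution A B C P F ρ G 𝒞 x xr xh χ) (hctrl : IsControllable A B)
    (hA : IsNeutrallyStable A) (hP : IsLyapunovMatrix A P) (hρ : 0 < ρ)
    (hF : IsHurwitz (A - F * C)) (hG : G ∈ rootedGraphs N 𝒞) (i : Fin N) : ExpDecay (χ i) := by
  have hf : ExpDecay fun t => xh i t - (exchange G (fun j => χ j t) i
      + leaderIndicator 𝒞 i • χ i t) := by
    have h1 := (ExpDecay.sum_smul Finset.univ (fun j => groundedLaplacian G 𝒞 i j)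
      (h.expDecay_tracking_error hA hF hG)).add
      ((h.expDecay_observer_error hF i).of_norm_le zero_le_one
        (g := fun t => -(∑ j, groundedLaplacian G 𝒞 i j • (x j t - xr t) - xh i t))
        fun t _ => by rw [one_mul, norm_neg])
    refine h1.of_norm_le zero_le_one fun t _ => ?_
    rw [one_mul]
    refine (congrArg norm ?_).le
    rw [exchange_add_smul_eq G 𝒞 (fun j => χ j t)]
    simp only [smul_sub, Finset.sum_sub_distrib]
    abel
  refine ExpDecay.of_saturated hctrl hP hρ (fun t ht => ?_) hf
  refine (h.controller i t ht).congr_deriv ?_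
  beta_reduce
  abel

theorem IsObserverSolution.regulatedSync
    (h : IsObserverSolution A B C P F ρ G 𝒞 x xr xh χ) (hctrl : IsControllable A B)
    (hA : IsNeutrallyStable A) (hP : IsLyapunovMatrix A P) (hρ : 0 < ρ)
    (hF : IsHurwitz (A - F * C)) (hG : G ∈ rootedGraphs N 𝒞) : RegulatedSync x xr := by
  have h1 : ∀ i, Tendsto (fun t => x i t - xr t) atTop (𝓝 0) := fun i => by
    simpa using ((h.expDecay_tracking_error hA hF hG i).add
      (h.expDecay_controller hctrl hA hP hρ hF hG i)).tendsto_zero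
  exact ⟨h1, fun i j => by simpa using (h1 i).sub (h1 j)⟩

end ClosedLoop

/-! ### Existence of closed-loop solutions -/

/-- `f` is Lipschitz for some constant. -/
def IsLipschitz {E F : Type*} [PseudoEMetricSpace E] [PseudoEMetricSpace F] (f : E → F) : Prop :=
  ∃ K, LipschitzWith K f

namespace IsLipschitz

variable {E F₁ F₂ : Type*} [PseudoEMetricSpace E] [SeminormedAddCommGroup F₁]
  [SeminormedAddCommGroup F₂]

theorem add {f g : E → F₁} (hf : IsLipschitz f) (hg : IsLipschitz g) :
    IsLipschitz fun x => f x + g x :=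
  ⟨_, hf.choose_spec.add hg.choose_spec⟩

theorem sub {f g : E → F₁} (hf : IsLipschitz f) (hg : IsLipschitz g) :
    IsLipschitz fun x => f x - g x :=
  ⟨_, hf.choose_spec.sub hg.choose_spec⟩

theorem const_smul [NormedSpace ℝ F₁] {f : E → F₁} (hf : IsLipschitz f) (c : ℝ) :
    IsLipschitz fun x => c • f x :=
  ⟨_, (lipschitzWith_smul c).comp hf.choose_spec⟩

theorem sum {κ : Type*} (s : Finset κ) {f : κ → E → F₁} (hf : ∀ k, IsLipschitz (f k)) :
    IsLipschitz fun x => ∑ k ∈ s, f k x := by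
  induction s using Finset.cons_induction with
  | empty => exact ⟨0, by simpa using LipschitzWith.const (0 : F₁)⟩
  | cons a s ha ih =>
    simp only [Finset.sum_cons]
    exact (hf a).add ih

theorem pi {κ : Type*} [Fintype κ] {f : E → κ → F₁} (hf : ∀ k, IsLipschitz fun x => f x k) :
    IsLipschitz f := by
  choose K hK using hf
  refine ⟨∑ k, K k, fun x y => (edist_pi_le_iff).2 fun k => (hK k x y).trans ?_⟩
  gcongr
  exact Finset.single_le_sum (f := K) (fun _ _ => zero_le) (Finset.mem_univ k)

theorem prodMk {f : E → F₁} {g : E → F₂} (hf : IsLipschitz f) (hg : IsLipschitz g) :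
    IsLipschitz fun x => (f x, g x) :=
  ⟨_, hf.choose_spec.prodMk hg.choose_spec⟩

theorem mulVec {κ ι : Type*} [Fintype κ] [Fintype ι] (M : Matrix κ ι ℝ) {f : E → ι → ℝ}
    (hf : IsLipschitz f) : IsLipschitz fun x => M *ᵥ f x :=
  ⟨_, (Matrix.mulVecLin M).toContinuousLinearMap.lipschitz.comp hf.choose_spec⟩

theorem satVec {m : ℕ} {f : E → Fin m → ℝ} (hf : IsLipschitz f) :
    IsLipschitz fun x => satVec (f x) :=
  ⟨_, lipschitzWith_satVec.comp hf.choose_spec⟩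

theorem eval {κ : Type*} [Fintype κ] {f : E → κ → F₁} (hf : IsLipschitz f) (k : κ) :
    IsLipschitz fun x => f x k :=
  ⟨_, (LipschitzWith.eval k).comp hf.choose_spec⟩

theorem exchange {N : ℕ} {κ : Type} [Fintype κ] (G : WeightedGraph N) {f : E → Fin N → κ → ℝ}
    (hf : IsLipschitz f) (i : Fin N) : IsLipschitz fun x => exchange G (f x) i :=
  sum _ fun j => ((hf.eval i).sub (hf.eval j)).const_smul _

theorem feedback {n m : ℕ} (B : Matrix (Fin n) (Fin m) ℝ) (P : Matrix (Fin n) (Fin n) ℝ) (ρ : ℝ)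
    {f : E → Fin n → ℝ} (hf : IsLipschitz f) : IsLipschitz fun x => feedback B P ρ (f x) := by
  have := (hf.mulVec (Bᵀ * P)).const_smul (-ρ)
  simpa only [SatMAS.feedback, neg_smul] using this

end IsLipschitz

/-- Saturation is 1-Lipschitz and every other operation is linear, so the joint vector field is
globally Lipschitz. -/
theorem exists_isObserverSolution {n m q N : ℕ} (A : Matrix (Fin n) (Fin n) ℝ)
    (B : Matrix (Fin n) (Fin m) ℝ) (C : Matrix (Fin q) (Fin n) ℝ) (P : Matrix (Fin n) (Fin n) ℝ)
    (F : Matrix (Fin n) (Fin q) ℝ) (ρ : ℝ) (G : WeightedGraph N) (𝒞 : Finset (Fin N))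
    (x₀ : Fin N → Fin n → ℝ) (xr₀ : Fin n → ℝ) (xh₀ χ₀ : Fin N → Fin n → ℝ) :
    ∃ x xr xh χ, IsObserverSolution A B C P F ρ G 𝒞 x xr xh χ ∧
      (∀ i, x i 0 = x₀ i) ∧ xr 0 = xr₀ ∧ (∀ i, xh i 0 = xh₀ i) ∧ ∀ i, χ i 0 = χ₀ i := by
  let S := (Fin N → Fin n → ℝ) × (Fin n → ℝ) × (Fin N → Fin n → ℝ) × (Fin N → Fin n → ℝ)
  let v : S → S := fun s =>
    (fun i => A *ᵥ s.1 i + B *ᵥ satVec (feedback B P ρ (s.2.2.2 i)), A *ᵥ s.2.1,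
      fun i => A *ᵥ s.2.2.1 i + B *ᵥ exchange G (fun j => satVec (feedback B P ρ (s.2.2.2 j))) i
        + F *ᵥ (measurement G 𝒞 (fun j => C *ᵥ s.1 j) (C *ᵥ s.2.1) i - C *ᵥ s.2.2.1 i)
        + leaderIndicator 𝒞 i • (B *ᵥ satVec (feedback B P ρ (s.2.2.2 i))),
      fun i => A *ᵥ s.2.2.2 i + B *ᵥ satVec (feedback B P ρ (s.2.2.2 i)) + s.2.2.1 i
        - exchange G (fun j => s.2.2.2 j) i - leaderIndicator 𝒞 i • s.2.2.2 i)
  have hv : IsLipschitz v := by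
    have h1 : IsLipschitz fun s : S => s.1 := ⟨_, LipschitzWith.prod_fst⟩
    have h2 : IsLipschitz fun s : S => s.2.1 :=
      ⟨_, LipschitzWith.prod_fst.comp LipschitzWith.prod_snd⟩
    have h3 : IsLipschitz fun s : S => s.2.2.1 :=
      ⟨_, LipschitzWith.prod_fst.comp (LipschitzWith.prod_snd.comp LipschitzWith.prod_snd)⟩
    have h4 : IsLipschitz fun s : S => s.2.2.2 :=
      ⟨_, LipschitzWith.prod_snd.comp (LipschitzWith.prod_snd.comp LipschitzWith.prod_snd)⟩
    have hu : ∀ i, IsLipschitz fun s : S => satVec (feedback B P ρ (s.2.2.2 i)) := fun i =>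
      ((h4.eval i).feedback B P ρ).satVec
    have hy : IsLipschitz fun s : S => fun j => C *ᵥ s.1 j :=
      IsLipschitz.pi fun j => (h1.eval j).mulVec C
    refine IsLipschitz.prodMk (IsLipschitz.pi fun i => ?_)
      (IsLipschitz.prodMk ?_ (IsLipschitz.prodMk (IsLipschitz.pi fun i => ?_)
        (IsLipschitz.pi fun i => ?_)))
    · exact ((h1.eval i).mulVec A).add ((hu i).mulVec B)
    · exact h2.mulVec A
    · exact ((((h3.eval i).mulVec A).add (((IsLipschitz.pi hu).exchange G i).mulVec B)).add
        ((((hy.exchange G i).add (((hy.eval i).sub (h2.mulVec C)).const_smul _)).sub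
          ((h3.eval i).mulVec C)).mulVec F)).add (((hu i).mulVec B).const_smul _)
    · exact (((((h4.eval i).mulVec A).add ((hu i).mulVec B)).add (h3.eval i)).sub
        (h4.exchange G i)).sub ((h4.eval i).const_smul _)
  obtain ⟨K, hK⟩ := hv
  obtain ⟨z, hz0, hz⟩ := exists_hasDerivWithinAt_Ici hK (x₀, xr₀, xh₀, χ₀)
  refine ⟨fun i t => (z t).1 i, fun t => (z t).2.1, fun i t => (z t).2.2.1 i,
    fun i t => (z t).2.2.2 i, ⟨fun i t ht => ?_, fun t ht => ?_, fun i t ht => ?_,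
    fun i t ht => ?_⟩, by simp [hz0], by simp [hz0], by simp [hz0], by simp [hz0]⟩
  · exact hasDerivWithinAt_pi.1 (hz t ht).fst i
  · exact (hz t ht).snd.fst
  · exact hasDerivWithinAt_pi.1 (hz t ht).snd.snd.fst i
  · exact hasDerivWithinAt_pi.1 (hz t ht).snd.snd.snd i

/-! ### The observer-based protocol as a linear protocol -/

section Protocol

variable {n m q : ℕ}

/-- The observer-based protocol with state `(x̂, χ)` and exchanged variable `(χ, σ(u))`. -/
noncomputable def observerProtocol (A : Matrix (Fin n) (Fin n) ℝ) (B : Matrix (Fin n) (Fin m) ℝ)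
    (C : Matrix (Fin q) (Fin n) ℝ) (P : Matrix (Fin n) (Fin n) ℝ) (F : Matrix (Fin n) (Fin q) ℝ)
    (ρ : ℝ) : LinearProtocol m q (Fin n ⊕ Fin n) (Fin n ⊕ Fin m) where
  Ac := Matrix.fromBlocks (A - F * C) 0 1 A
  Bc := Matrix.fromRows 0 B
  Cc := Matrix.fromRows F 0
  Dc := Matrix.fromBlocks 0 B (-1) 0
  Aι := Matrix.fromBlocks 0 0 0 (-1)
  Bι := Matrix.fromRows B 0
  Fc := Matrix.fromCols 0 (-(ρ • (Bᵀ * P)))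
  Hc := Matrix.fromBlocks 0 1 0 0
  Gc := Matrix.fromRows 0 1

variable {A P : Matrix (Fin n) (Fin n) ℝ} {B : Matrix (Fin n) (Fin m) ℝ}
  {C : Matrix (Fin q) (Fin n) ℝ} {F : Matrix (Fin n) (Fin q) ℝ} {ρ : ℝ}

theorem observerProtocol_input (a b : Fin n → ℝ) :
    (observerProtocol A B C P F ρ).input (Sum.elim a b) = feedback B P ρ b := by
  simp [observerProtocol, LinearProtocol.input, feedback, Matrix.fromCols_mulVec, Matrix.neg_mulVec,
    Matrix.smul_mulVec]

theorem observerProtocol_exchanged (a b : Fin n → ℝ) :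
    (observerProtocol A B C P F ρ).exchanged (Sum.elim a b)
      = Sum.elim b (satVec (feedback B P ρ b)) := by
  rw [LinearProtocol.exchanged, observerProtocol_input]
  ext (k | k) <;>
    simp [observerProtocol, Matrix.fromBlocks_mulVec, Matrix.fromRows_mulVec]

theorem exchange_sumElim {N : ℕ} {κ ν : Type} (G : WeightedGraph N) (f : Fin N → κ → ℝ)
    (g : Fin N → ν → ℝ) (i : Fin N) :
    exchange G (fun j => Sum.elim (f j) (g j)) i = Sum.elim (exchange G f i) (exchange G g i) := by
  ext (k | k) <;> simp [exchange, Finset.sum_apply]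

theorem hasDynamics_sumElim {κ ν : Type} [Fintype κ] [Fintype ν] {f f' : ℝ → κ → ℝ}
    {g g' : ℝ → ν → ℝ} :
    HasDynamics (fun t => Sum.elim (f t) (g t)) (fun t => Sum.elim (f' t) (g' t)) ↔
      HasDynamics f f' ∧ HasDynamics g g' := by
  simp only [HasDynamics, hasDerivWithinAt_pi, Sum.forall, Sum.elim_inl, Sum.elim_inr]
  exact ⟨fun h => ⟨fun t ht => (h t ht).1, fun t ht => (h t ht).2⟩,
    fun h t ht => ⟨h.1 t ht, h.2 t ht⟩⟩

theorem observerProtocol_isSolution_iff {N : ℕ} {G : WeightedGraph N} {𝒞 : Finset (Fin N)}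
    {x : Fin N → ℝ → Fin n → ℝ} {xr : ℝ → Fin n → ℝ} {xh χ : Fin N → ℝ → Fin n → ℝ} :
    (observerProtocol A B C P F ρ).IsSolution A B C G 𝒞 x xr (fun i t => Sum.elim (xh i t) (χ i t))
      ↔ IsObserverSolution A B C P F ρ G 𝒞 x xr xh χ := by
  have key : ∀ i, (fun t =>
      (observerProtocol A B C P F ρ).Ac *ᵥ Sum.elim (xh i t) (χ i t)
      + (observerProtocol A B C P F ρ).Bc *ᵥ satVec (feedback B P ρ (χ i t))
      + (observerProtocol A B C P F ρ).Cc *ᵥ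
        measurement G 𝒞 (fun j => C *ᵥ x j t) (C *ᵥ xr t) i
      + (observerProtocol A B C P F ρ).Dc *ᵥ
        Sum.elim (exchange G (fun j => χ j t) i)
          (exchange G (fun j => satVec (feedback B P ρ (χ j t))) i)
      + leaderIndicator 𝒞 i • ((observerProtocol A B C P F ρ).Aι *ᵥ Sum.elim (xh i t) (χ i t)
        + (observerProtocol A B C P F ρ).Bι *ᵥ satVec (feedback B P ρ (χ i t))))
      = fun t => Sum.elim
        (A *ᵥ xh i t + B *ᵥ exchange G (fun j => satVec (feedback B P ρ (χ j t))) i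
          + F *ᵥ (measurement G 𝒞 (fun j => C *ᵥ x j t) (C *ᵥ xr t) i - C *ᵥ xh i t)
          + leaderIndicator 𝒞 i • (B *ᵥ satVec (feedback B P ρ (χ i t))))
        (A *ᵥ χ i t + B *ᵥ satVec (feedback B P ρ (χ i t)) + xh i t
          - exchange G (fun j => χ j t) i - leaderIndicator 𝒞 i • χ i t) := by
    intro i
    ext t (k | k)
    · simp [observerProtocol, Matrix.fromBlocks_mulVec, Matrix.fromRows_mulVec, Matrix.sub_mulVec,
        Matrix.mulVec_sub]
      ring
    · simp [observerProtocol, Matrix.fromBlocks_mulVec, Matrix.fromRows_mulVec, Matrix.neg_mulVec]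
      ring
  constructor
  · rintro ⟨h1, h2, h3⟩
    simp only [observerProtocol_input, observerProtocol_exchanged, exchange_sumElim, key,
      hasDynamics_sumElim] at h1 h3
    exact ⟨h1, h2, fun i => (h3 i).1, fun i => (h3 i).2⟩
  · rintro ⟨h1, h2, h3, h4⟩
    refine ⟨?_, h2, ?_⟩ <;>
    simp only [observerProtocol_input, observerProtocol_exchanged, exchange_sumElim, key,
      hasDynamics_sumElim]
    exacts [h1, fun i => ⟨h3 i, h4 i⟩]

theorem observerProtocol_achievesScalableSync
    (h : ∀ (N : ℕ) (𝒞 : Finset (Fin N)), 𝒞.Nonempty → ∀ G ∈ rootedGraphs N 𝒞,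
      ObserverProtocolAchievesSync A B C P F ρ G 𝒞) :
    (observerProtocol A B C P F ρ).AchievesScalableSync A B C := by
  intro N 𝒞 h𝒞 G hG
  obtain ⟨hex, hsync⟩ := h N 𝒞 h𝒞 G hG
  refine ⟨fun x₀ xr₀ xc₀ => ?_, fun x xr xc hsol => ?_⟩
  · obtain ⟨x, xr, xh, χ, hsol, h1, h2, h3, h4⟩ :=
      hex x₀ xr₀ (fun i a => xc₀ i (Sum.inl a)) (fun i a => xc₀ i (Sum.inr a))
    refine ⟨x, xr, _, observerProtocol_isSolution_iff.2 hsol, h1, h2, fun i => ?_⟩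
    ext (k | k) <;> simp [h3, h4]
  -- Every protocol state is the `Sum.elim` of its two halves, so arbitrary solutions are covered.
  · refine hsync x xr (fun i t a => xc i t (Sum.inl a)) (fun i t a => xc i t (Sum.inr a))
      (observerProtocol_isSolution_iff.1 ?_)
    convert hsol using 3
    ext (k | k) <;> rfl

end Protocol

end SatMAS

theorem mainTheorem5 {n m q : ℕ}
    (A : Matrix (Fin n) (Fin n) ℝ) (B : Matrix (Fin n) (Fin m) ℝ) (C : Matrix (Fin q) (Fin n) ℝ)
    (hctrl : SatMAS.IsControllable A B) (hobs : SatMAS.IsObservable A C)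
    (hA : SatMAS.IsNeutrallyStable A) :
    SatMAS.ScalableSyncSolvable A B C ∧
    (∃ P : Matrix (Fin n) (Fin n) ℝ, SatMAS.IsLyapunovMatrix A P) ∧
    (∃ F : Matrix (Fin n) (Fin q) ℝ, SatMAS.IsHurwitz (A - F * C)) ∧
    ∀ (ρ : ℝ), 0 < ρ →
      ∀ (P : Matrix (Fin n) (Fin n) ℝ), SatMAS.IsLyapunovMatrix A P →
      ∀ (F : Matrix (Fin n) (Fin q) ℝ), SatMAS.IsHurwitz (A - F * C) →
      ∀ (N : ℕ) (𝒞 : Finset (Fin N)), 𝒞.Nonempty → ∀ G ∈ SatMAS.rootedGraphs N 𝒞,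
        SatMAS.ObserverProtocolAchievesSync A B C P F ρ G 𝒞 := by
  have hmain : ∀ (ρ : ℝ), 0 < ρ →
      ∀ (P : Matrix (Fin n) (Fin n) ℝ), SatMAS.IsLyapunovMatrix A P →
      ∀ (F : Matrix (Fin n) (Fin q) ℝ), SatMAS.IsHurwitz (A - F * C) →
      ∀ (N : ℕ) (𝒞 : Finset (Fin N)), 𝒞.Nonempty → ∀ G ∈ SatMAS.rootedGraphs N 𝒞,
        SatMAS.ObserverProtocolAchievesSync A B C P F ρ G 𝒞 :=
    fun ρ hρ P hP F hF N 𝒞 _ G hG =>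
      ⟨SatMAS.exists_isObserverSolution A B C P F ρ G 𝒞,
        fun _ _ _ _ h => h.regulatedSync hctrl hA hP hρ hF hG⟩
  obtain ⟨P, hP⟩ := SatMAS.exists_isLyapunovMatrix hA
  have hF := SatMAS.isHurwitz_observer hobs hP
  -- The witnesses are `ρ = 1` and `F = P⁻¹ Cᵀ`, with `P` from neutral stability; they depend only
  -- on `A` and `C`.
  exact ⟨⟨_, _, _, _, _, SatMAS.observerProtocol_achievesScalableSync
    (hmain 1 one_pos P hP _ hF)⟩, ⟨P, hP⟩, ⟨_, hF⟩, hmain⟩
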